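/- Let $\mathsf X$ be a Polish space with its Borel $\sigma$-algebra, $(M_n)_{n\ge1}$ Markov kernels on $\mathsf X$, $(G_n)_{n\ge0}$ measurable, strictly positive, real-valued functions on $\mathsf X$, and $\mu$ a probability measure on $\mathsf X$. Put $Q_n(x,dx')=G_{n-1}(x)M_n(x,dx')$ for $n\ge 1$, $Q_{p,n}=Q_{p+1}\cdots Q_n$ for $p<n$, $Q_{n,n}=\mathrm{Id}$, and $$\gamma_n=\mu Q_{0,n},\qquad \eta_n=\frac{\gamma_n}{\gamma_n(1)},\qquad \lambda_n=\eta_n(G_n),\qquad h_{p,n}=\frac{Q_{p,n}(1)}{\prod_{q=p}^{n-1}\lambda_q}\quad(h_{n,n}=1).$$ For bounded measurable $\varphi:\mathsf X\to\mathbb R$ and $n\ge1$, the asymptotic variance for the particle approximation of $\eta_n(\varphi)$ is defined by $$\sigma_n^2:=\eta_n\big[(\varphi-\eta_n(\varphi))^2\big]+\sum_{p=0}^{n-1}\eta_p\Big[\Big(\frac{Q_{p,n}(\varphi)}{\prod_{q=p}^{n-1}\lambda_q}-h_{p,n}\,\eta_n(\varphi)\Big)^2\Big].$$ Let $V:\mathsf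 X\to[1,\infty)$ be measurable and unbounded, $v=e^V$, $C_d=\{x: V(x)\le d\}$; let $\delta>0$, $\underline d\ge1$, $\bar G<\infty$, and for every $d\in[\underline d,\infty)$ let $b_d<\infty$, $0<\epsilon_d^-\le\epsilon_d^+<\infty$, and let $\nu_d$ be a probability measure with $\nu_d(v)<\infty$. Assume: (H1) $Q_n(e^V)(x)\le \exp\big(V(x)(1-\delta)+b_d\mathbb I_{C_d}(x)\big)$ for all $n\ge1$, $x\in\mathsf X$, $d\ge\underline d$; (H2) $\mu(v)<\infty$; (H3) for all $d\ge\underline d$ and $n\ge1$: $Q_n(x,C_d)>0$ for all $x\in\mathsf X$; $Q_n(x,C_d\cap A)\ge\epsilon_d^-\nu_d(C_d\cap A)$ for all $x\in C_d$ and Borel $A$; and $\nu_d(C_r)>0$ for all $r\in[\underline d,d]$; (H4) for all $d\ge\underline d$ and $n\ge1$: $Q_n(x,C_d\cap A)\le\epsilon_d^+\nu_d(C_d\cap A)$ for all $x\in C_d$ and Borel $A$; (H5) $G_n(x)\le\bar G$ for all $n\ge0$ and $x\in\mathsf X$. Then there is a constant $c_\mu<\infty$, depending only on $\mu$ and on $V,\delta,\underline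 d,(b_d),(\epsilon_d^-),(\epsilon_d^+),(\nu_d),\bar G$ (and so not on $n$, on $\varphi$, or otherwise on $(M_n)$ and $(G_n)$), such that for every bounded measurable $\varphi$ and every $n\ge1$, $$\sigma_n^2\le\eta_n\big[(\varphi-\eta_n(\varphi))^2\big]+c_\mu\,\|\varphi\|^2\,\mu(v)^2,\qquad \|\varphi\|:=\sup_{x\in\mathsf X}|\varphi(x)|.$$ -/

import Mathlib

open MeasureTheory ProbabilityTheory

/-- A Feynman-Kac model on `X`: Markov kernels `M n` (only the indices `n ≥ 1` are ever used) and
measurable, strictly positive potential functions `G n`, `n ≥ 0`. -/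
structure FKModel (X : Type*) [MeasurableSpace X] where
  /-- the Markov kernels -/
  M : ℕ → Kernel X X
  markov : ∀ n, IsMarkovKernel (M n)
  /-- the potential functions -/
  G : ℕ → X → ℝ
  measurable_G : ∀ n, Measurable (G n)
  G_pos : ∀ n x, 0 < G n x

namespace FKModel

attribute [instance] FKModel.markov

/-- The weighted supremum norm `sup_x |φ x| / v x`. -/
noncomputable def weightedNorm {X : Type*} (v φ : X → ℝ) : ℝ := ⨆ x, |φ x| / v x

/-- The sublevel set `C_d = {x ; V x ≤ d}`. -/
def levelSet {X : Type*} (V : X → ℝ) (d : ℝ) : Set X := {x | V x ≤ d}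

/-- `η ∈ 𝒫_v` for `v = exp V`: `η` is a probability measure with `η(v) < ∞`. -/
def MemPv {X : Type*} [MeasurableSpace X] (V : X → ℝ) (η : Measure X) : Prop :=
  IsProbabilityMeasure η ∧ ∫⁻ x, ENNReal.ofReal (Real.exp (V x)) ∂η < ⊤

variable {X : Type*} [MeasurableSpace X]

/-- The integral kernel `Q_n(x, dx') = G_{n-1}(x) M_n(x, dx')`, used for `n ≥ 1`. -/
noncomputable def Q (F : FKModel X) (n : ℕ) : Kernel X X :=
  (F.M n).withDensity (fun x _ => ENNReal.ofReal (F.G (n - 1) x))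

/-- `Q_{p+1} Q_{p+2} ⋯ Q_{p+k}`, the identity kernel for `k = 0`. -/
noncomputable def Qsteps (F : FKModel X) (p : ℕ) : ℕ → Kernel X X
  | 0 => Kernel.id
  | k + 1 => F.Q (p + k + 1) ∘ₖ Qsteps F p k

/-- The semigroup `Q_{p,n} = Q_{p+1} ⋯ Q_n` for `p < n`, and `Q_{n,n} = Id`. -/
noncomputable def Qsemi (F : FKModel X) (p n : ℕ) : Kernel X X := F.Qsteps p (n - p)

/-- The unnormalized measure `γ_n = μ Q_{0,n}`. -/
noncomputable def gamma (F : FKModel X) (μ : Measure X) (n : ℕ) : Measure X :=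
  F.Qsemi 0 n ∘ₘ μ

/-- The normalized measure `η_n = γ_n / γ_n(1)`. -/
noncomputable def eta (F : FKModel X) (μ : Measure X) (n : ℕ) : Measure X :=
  (F.gamma μ n Set.univ)⁻¹ • F.gamma μ n

/-- `λ_n = η_n(G_n)`. -/
noncomputable def lam (F : FKModel X) (μ : Measure X) (n : ℕ) : ℝ :=
  ∫ x, F.G n x ∂(F.eta μ n)

/-- `Q_{p,n}(φ)(x) / ∏_{q=p}^{n-1} λ_q`. -/
noncomputable def normalizedSemi (F : FKModel X) (μ : Measure X) (φ : X → ℝ) (p n : ℕ) (x : X) :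
    ℝ :=
  (∫ y, φ y ∂(F.Qsemi p n x)) / ∏ q ∈ Finset.Ico p n, F.lam μ q

/-- `h_{p,n}(x) = Q_{p,n}(1)(x) / ∏_{q=p}^{n-1} λ_q`, so that `h_{n,n} = 1`. -/
noncomputable def h (F : FKModel X) (μ : Measure X) (p n : ℕ) (x : X) : ℝ :=
  F.normalizedSemi μ (fun _ => 1) p n x

/-- The variance `η_n[(φ - η_n(φ))²]`. -/
noncomputable def varEta (F : FKModel X) (μ : Measure X) (φ : X → ℝ) (n : ℕ) : ℝ :=
  ∫ x, (φ x - ∫ y, φ y ∂(F.eta μ n)) ^ 2 ∂(F.eta μ n)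

/-- The asymptotic variance `σ_n²` of the particle approximation of `η_n(φ)`. -/
noncomputable def sigmaSq (F : FKModel X) (μ : Measure X) (φ : X → ℝ) (n : ℕ) : ℝ :=
  F.varEta μ φ n +
    ∑ p ∈ Finset.range n,
      ∫ x, (F.normalizedSemi μ φ p n x - F.h μ p n x * ∫ y, φ y ∂(F.eta μ n)) ^ 2 ∂(F.eta μ p)

/-- Multiplicative drift condition, simultaneous in time, with drift function `v = exp V`. -/
structure Drift (F : FKModel X) (V : X → ℝ) (δ dlow : ℝ) (b : ℝ → ℝ) : Prop where
  measurable_V : Measurable V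
  one_le_V : ∀ x, 1 ≤ V x
  unbounded_V : ¬ BddAbove (Set.range V)
  delta_pos : 0 < δ
  one_le_dlow : 1 ≤ dlow
  drift : ∀ d, dlow ≤ d → ∀ n, 1 ≤ n → ∀ x,
    ∫⁻ y, ENNReal.ofReal (Real.exp (V y)) ∂(F.Q n x) ≤
      ENNReal.ofReal
        (Real.exp (V x * (1 - δ) + b d * (levelSet V d).indicator (fun _ => (1 : ℝ)) x))

/-- Accessibility of the level sets and local minorization on them. -/
structure Minorization (F : FKModel X) (V : X → ℝ) (dlow : ℝ) (εm : ℝ → ℝ) (ν : ℝ → Measure X) :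
    Prop where
  accessible : ∀ d, dlow ≤ d → ∀ n, 1 ≤ n → ∀ x, 0 < F.Q n x (levelSet V d)
  eps_pos : ∀ d, dlow ≤ d → 0 < εm d
  nu_mem : ∀ d, dlow ≤ d → MemPv V (ν d)
  minor : ∀ d, dlow ≤ d → ∀ n, 1 ≤ n → ∀ x ∈ levelSet V d, ∀ A, MeasurableSet A →
    ENNReal.ofReal (εm d) * ν d (levelSet V d ∩ A) ≤ F.Q n x (levelSet V d ∩ A)
  nu_pos : ∀ d, dlow ≤ d → ∀ r ∈ Set.Icc dlow d, 0 < ν d (levelSet V r)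

/-- Local majorization on the level sets, with the same measures `ν d`. -/
structure Majorization (F : FKModel X) (V : X → ℝ) (dlow : ℝ) (εm εp : ℝ → ℝ)
    (ν : ℝ → Measure X) : Prop where
  eps_le : ∀ d, dlow ≤ d → εm d ≤ εp d
  major : ∀ d, dlow ≤ d → ∀ n, 1 ≤ n → ∀ x ∈ levelSet V d, ∀ A, MeasurableSet A →
    F.Q n x (levelSet V d ∩ A) ≤ ENNReal.ofReal (εp d) * ν d (levelSet V d ∩ A)

/-- The potentials are bounded by `Gbar`, uniformly in time and space. -/
def BoundedPotentials (F : FKModel X) (Gbar : ℝ) : Prop := ∀ n x, F.G n x ≤ Gbar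

end FKModel

namespace FKModel

variable {X : Type*} [MeasurableSpace X]

/-! The `p`-th term of the variance is controlled by a pointwise geometric bound: with `w = exp (V /
2)`, the centred normalized semigroup at `x` is at most a constant times `‖φ‖ r ^ (n - p) w x` for
some `r < 1` (`exists_enorm_normalizedSemi_sub_le`). Squaring turns `w` into `v`, whose integrals
`η_p(v)` are bounded uniformly in time (`exists_lintegral_expV_eta_le`), and a geometric series
remains. Boundedness of the potentials is what transfers the drift from `v` to its square root, by
Cauchy-Schwarz.

The geometric bound comes from two independent copies. The function `pairDiff`, that is `Q_{p,n}φ ⊗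
Q_{p,n}1 - Q_{p,n}1 ⊗ Q_{p,n}φ`, is propagated by the tensor squares of the kernels; integrating one
variable against `η_p` recovers the centred semigroup (`normalizedSemi_sub_eq`). It is
antisymmetric, so a product measure `m ⊗ m` annihilates it, and the local minorization by `m` gives
a contraction on `C × C` (`enorm_pairDiff_le_lintegral`). Outside `C × C` the drift of a coordinate
outside `C` takes over.

The kernels are not Markov, and the growth `K` of `w` may exceed the lower bound `l` of the
normalizing increments. Hence the induction uses `w ^ θ * Q_{p,n}(1) ^ (1 - θ)`: by Hölder it costs
only `K ^ θ` per step, while after normalization the masses are dominated by `w`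
(`mass_le_piecewise`). The excess is then only `(K / l) ^ (2θ)`, and a small `θ` lets the local
contraction beat it. -/

lemma Q_apply (F : FKModel X) (n : ℕ) (x : X) :
    F.Q n x = ENNReal.ofReal (F.G (n - 1) x) • F.M n x := by
  have hm : Measurable (Function.uncurry fun (x : X) (_ : X) => ENNReal.ofReal (F.G (n - 1) x)) :=
    ((F.measurable_G (n - 1)).comp measurable_fst).ennreal_ofReal
  rw [Q, Kernel.withDensity_apply _ hm, withDensity_const]

lemma Q_univ (F : FKModel X) (n : ℕ) (x : X) :
    F.Q n x Set.univ = ENNReal.ofReal (F.G (n - 1) x) := by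
  simp [Q_apply]

lemma BoundedPotentials.isFiniteKernel_Q {F : FKModel X} {Gbar : ℝ} (hF : F.BoundedPotentials Gbar)
    (n : ℕ) : IsFiniteKernel (F.Q n) :=
  Kernel.isFiniteKernel_withDensity_of_bounded _ (ENNReal.ofReal_ne_top (r := Gbar))
    fun x _ => ENNReal.ofReal_le_ofReal (hF _ x)

lemma Qsteps_isFiniteKernel {F : FKModel X} (hQ : ∀ n, IsFiniteKernel (F.Q n)) (p k : ℕ) :
    IsFiniteKernel (F.Qsteps p k) := by
  induction k with
  | zero => simp only [Qsteps]; infer_instance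
  | succ k ih => simp only [Qsteps]; have := hQ (p + k + 1); infer_instance

lemma Qsemi_isFiniteKernel {F : FKModel X} (hQ : ∀ n, IsFiniteKernel (F.Q n)) (p n : ℕ) :
    IsFiniteKernel (F.Qsemi p n) := Qsteps_isFiniteKernel hQ _ _

/-! ### Semigroup identities and the unnormalized flow. -/

lemma Qsemi_self (F : FKModel X) (n : ℕ) : F.Qsemi n n = Kernel.id := by
  simp [Qsemi, Qsteps]

lemma Qsemi_succ_right (F : FKModel X) {p n : ℕ} (hpn : p ≤ n) :
    F.Qsemi p (n + 1) = F.Q (n + 1) ∘ₖ F.Qsemi p n := by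
  have h1 : n + 1 - p = (n - p) + 1 := by omega
  have h2 : p + (n - p) + 1 = n + 1 := by omega
  rw [Qsemi, h1, Qsteps, h2, Qsemi]

lemma Qsemi_comp (F : FKModel X) {p q n : ℕ} (hpq : p ≤ q) (hqn : q ≤ n) :
    F.Qsemi p n = F.Qsemi q n ∘ₖ F.Qsemi p q := by
  induction n, hqn using Nat.le_induction with
  | base => rw [Qsemi_self, Kernel.id_comp]
  | succ n hn ih =>
    rw [Qsemi_succ_right F (hpq.trans hn), ih, Qsemi_succ_right F hn, Kernel.comp_assoc]

lemma Qsemi_succ_left (F : FKModel X) {p n : ℕ} (hpn : p < n) :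
    F.Qsemi p n = F.Qsemi (p + 1) n ∘ₖ F.Q (p + 1) := by
  rw [Qsemi_comp F (Nat.le_succ p) hpn, Qsemi_succ_right F le_rfl, Qsemi_self, Kernel.comp_id]

lemma gamma_zero (F : FKModel X) (μ : Measure X) : F.gamma μ 0 = μ := by
  rw [gamma, Qsemi_self, Measure.id_comp]

lemma gamma_comp (F : FKModel X) (μ : Measure X) {p n : ℕ} (hpn : p ≤ n) :
    F.gamma μ n = F.Qsemi p n ∘ₘ F.gamma μ p := by
  rw [gamma, gamma, Measure.comp_assoc, ← Qsemi_comp F (Nat.zero_le p) hpn]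

lemma gamma_succ (F : FKModel X) (μ : Measure X) (n : ℕ) :
    F.gamma μ (n + 1) = F.Q (n + 1) ∘ₘ F.gamma μ n := by
  rw [gamma_comp F μ (Nat.le_succ n), Qsemi_succ_right F le_rfl, Qsemi_self, Kernel.comp_id]

lemma lintegral_gamma_succ (F : FKModel X) (μ : Measure X) (n : ℕ) {f : X → ENNReal}
    (hf : Measurable f) :
    ∫⁻ x, f x ∂(F.gamma μ (n + 1)) = ∫⁻ x, ∫⁻ y, f y ∂(F.Q (n + 1) x) ∂(F.gamma μ n) := by
  rw [gamma_succ, Measure.lintegral_bind (F.Q (n + 1)).measurable.aemeasurable hf.aemeasurable]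

lemma gamma_isFiniteMeasure {F : FKModel X} (hQ : ∀ n, IsFiniteKernel (F.Q n)) (μ : Measure X)
    [IsFiniteMeasure μ] (n : ℕ) : IsFiniteMeasure (F.gamma μ n) := by
  have := Qsemi_isFiniteKernel hQ 0 n
  unfold gamma; infer_instance

lemma gamma_univ_ne_zero (F : FKModel X) (μ : Measure X) [IsProbabilityMeasure μ] (n : ℕ) :
    F.gamma μ n Set.univ ≠ 0 := by
  induction n with
  | zero => simp [gamma_zero]
  | succ n ih =>
    rw [← lintegral_one, lintegral_gamma_succ F μ n measurable_const]
    simp only [lintegral_one]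
    intro h0
    rw [lintegral_eq_zero_iff ((F.Q (n + 1)).measurable_coe MeasurableSet.univ)] at h0
    have : ∀ᵐ x ∂(F.gamma μ n), False := by
      filter_upwards [h0] with x hx
      have := F.G_pos n x
      simp [Q_univ] at hx
      linarith
    rw [Filter.eventually_false_iff_eq_bot, ae_eq_bot] at this
    exact ih (by simp [this])

/-! ### Total masses and normalizing constants. -/

/-- The total mass `Q_{p,n}(1)(x)`. -/
noncomputable def mass (F : FKModel X) (p n : ℕ) (x : X) : ENNReal := F.Qsemi p n x Set.univ

lemma measurable_mass (F : FKModel X) (p n : ℕ) : Measurable (F.mass p n) :=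
  (F.Qsemi p n).measurable_coe MeasurableSet.univ

lemma mass_self (F : FKModel X) (n : ℕ) (x : X) : F.mass n n x = 1 := by
  simp [mass, Qsemi_self]

lemma mass_succ_left (F : FKModel X) {p n : ℕ} (hpn : p < n) (x : X) :
    F.mass p n x = ∫⁻ y, F.mass (p + 1) n y ∂(F.Q (p + 1) x) := by
  rw [mass, Qsemi_succ_left F hpn, Kernel.comp_apply' _ _ _ MeasurableSet.univ]; rfl

lemma mass_ne_top {F : FKModel X} (hQ : ∀ n, IsFiniteKernel (F.Q n)) (p n : ℕ) (x : X) :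
    F.mass p n x ≠ ⊤ := by
  have := Qsemi_isFiniteKernel hQ p n
  exact measure_ne_top _ _

lemma eta_isProbabilityMeasure {F : FKModel X} (hQ : ∀ n, IsFiniteKernel (F.Q n)) (μ : Measure X)
    [IsProbabilityMeasure μ] (n : ℕ) : IsProbabilityMeasure (F.eta μ n) := by
  have := gamma_isFiniteMeasure hQ μ n
  refine ⟨?_⟩
  simp only [eta, Measure.smul_apply, smul_eq_mul]
  exact ENNReal.inv_mul_cancel (F.gamma_univ_ne_zero μ n) (measure_ne_top _ _)

lemma lintegral_eta (F : FKModel X) (μ : Measure X) (n : ℕ) (f : X → ENNReal) :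
    ∫⁻ x, f x ∂(F.eta μ n) = (F.gamma μ n Set.univ)⁻¹ * ∫⁻ x, f x ∂(F.gamma μ n) := by
  rw [eta, lintegral_smul_measure, smul_eq_mul]

/-- The normalizing constant `η_p Q_{p,n}(1)`. -/
noncomputable def evid (F : FKModel X) (μ : Measure X) (p n : ℕ) : ENNReal :=
  ∫⁻ x, F.mass p n x ∂(F.eta μ p)

lemma gamma_univ_eq (F : FKModel X) (μ : Measure X) {p n : ℕ} (hpn : p ≤ n) :
    F.gamma μ n Set.univ = ∫⁻ x, F.mass p n x ∂(F.gamma μ p) := by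
  rw [gamma_comp F μ hpn, Measure.bind_apply MeasurableSet.univ (F.Qsemi p n).aemeasurable]; rfl

lemma evid_eq (F : FKModel X) (μ : Measure X) {p n : ℕ} (hpn : p ≤ n) :
    F.evid μ p n = (F.gamma μ p Set.univ)⁻¹ * F.gamma μ n Set.univ := by
  rw [evid, lintegral_eta, gamma_univ_eq F μ hpn]

lemma evid_self {F : FKModel X} (hQ : ∀ n, IsFiniteKernel (F.Q n)) (μ : Measure X)
    [IsProbabilityMeasure μ] (n : ℕ) : F.evid μ n n = 1 := by
  have := eta_isProbabilityMeasure hQ μ n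
  simp [evid, mass_self]

lemma evid_mul {F : FKModel X} (hQ : ∀ n, IsFiniteKernel (F.Q n)) (μ : Measure X)
    [IsProbabilityMeasure μ] {p q n : ℕ} (hpq : p ≤ q) (hqn : q ≤ n) :
    F.evid μ p n = F.evid μ p q * F.evid μ q n := by
  have := gamma_isFiniteMeasure hQ μ q
  rw [evid_eq F μ hpq, evid_eq F μ hqn, evid_eq F μ (hpq.trans hqn), mul_assoc,
    ENNReal.mul_inv_cancel_left (F.gamma_univ_ne_zero μ q) (measure_ne_top _ _)]

lemma evid_ne_zero {F : FKModel X} (hQ : ∀ n, IsFiniteKernel (F.Q n)) (μ : Measure X)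
    [IsProbabilityMeasure μ] {p n : ℕ} (hpn : p ≤ n) : F.evid μ p n ≠ 0 := by
  have := gamma_isFiniteMeasure hQ μ p
  rw [evid_eq F μ hpn]
  exact mul_ne_zero (ENNReal.inv_ne_zero.2 (measure_ne_top _ _)) (F.gamma_univ_ne_zero μ n)

lemma evid_ne_top {F : FKModel X} (hQ : ∀ n, IsFiniteKernel (F.Q n)) (μ : Measure X)
    [IsProbabilityMeasure μ] {p n : ℕ} (hpn : p ≤ n) : F.evid μ p n ≠ ⊤ := by
  have := gamma_isFiniteMeasure hQ μ n
  rw [evid_eq F μ hpn]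
  exact ENNReal.mul_ne_top (ENNReal.inv_ne_top.2 (F.gamma_univ_ne_zero μ p)) (measure_ne_top _ _)

lemma evid_succ (F : FKModel X) (μ : Measure X) (p : ℕ) :
    F.evid μ p (p + 1) = ∫⁻ x, ENNReal.ofReal (F.G p x) ∂(F.eta μ p) := by
  rw [evid]
  refine lintegral_congr fun x => ?_
  rw [mass_succ_left F p.lt_succ_self]
  simp [mass_self, Q_univ]

lemma lam_eq (F : FKModel X) (μ : Measure X) (p : ℕ) :
    F.lam μ p = (F.evid μ p (p + 1)).toReal := by
  rw [lam, evid_succ, integral_eq_lintegral_of_nonneg_ae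
    (Filter.Eventually.of_forall fun x => (F.G_pos p x).le)
    (F.measurable_G p).aestronglyMeasurable]

/-- The one-step constants telescope by `evid_mul`, so the denominator of the normalized semigroup
is the single number `η_p Q_{p,n}(1)`. -/
lemma prod_lam_eq {F : FKModel X} (hQ : ∀ n, IsFiniteKernel (F.Q n)) (μ : Measure X)
    [IsProbabilityMeasure μ] {p n : ℕ} (hpn : p ≤ n) :
    ∏ q ∈ Finset.Ico p n, F.lam μ q = (F.evid μ p n).toReal := by
  induction n, hpn using Nat.le_induction with
  | base => simp [evid_self hQ]
  | succ n hn ih =>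
    rw [Finset.prod_Ico_succ_top hn, ih, lam_eq, evid_mul hQ μ hn n.le_succ, ENNReal.toReal_mul]

lemma pow_le_evid {F : FKModel X} (hQ : ∀ n, IsFiniteKernel (F.Q n)) (μ : Measure X)
    [IsProbabilityMeasure μ] {l : ENNReal} (hl : ∀ p, l ≤ F.evid μ p (p + 1)) {p n : ℕ}
    (hpn : p ≤ n) : l ^ (n - p) ≤ F.evid μ p n := by
  induction n, hpn using Nat.le_induction with
  | base => simp [evid_self hQ]
  | succ n hn ih =>
    rw [evid_mul hQ μ hn n.le_succ, Nat.succ_sub hn, pow_succ]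
    exact mul_le_mul' ih (hl n)

/-! ### Level sets and one-step consequences of drift and minorization. -/

lemma measurableSet_levelSet {V : X → ℝ} (hV : Measurable V) (d : ℝ) :
    MeasurableSet (levelSet V d) := measurableSet_le hV measurable_const

lemma levelSet_mono {X : Type*} (V : X → ℝ) {d e : ℝ} (h : d ≤ e) : levelSet V d ⊆ levelSet V e :=
  fun _ hx => le_trans hx h

lemma eventually_ofReal_exp_le {δ : ℝ} (hδ : 0 < δ) (B : ℝ) {c : ENNReal} (hc : c ≠ 0) :
    ∀ᶠ d in Filter.atTop, ENNReal.ofReal (Real.exp (B - δ * d)) ≤ c := by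
  have h1 : Filter.Tendsto (fun d : ℝ => B - δ * d) Filter.atTop Filter.atBot := by
    have := (Filter.tendsto_id (α := ℝ) (x := Filter.atTop)).const_mul_atTop hδ
    exact Filter.tendsto_atBot_add_const_left _ B (Filter.tendsto_neg_atTop_atBot.comp this)
  have h2 := ENNReal.tendsto_ofReal (Real.tendsto_exp_atBot.comp h1)
  rw [ENNReal.ofReal_zero] at h2
  exact h2.eventually_le_const (pos_iff_ne_zero.2 hc)

lemma eventually_measure_levelSet_ne_zero (V : X → ℝ) (μ : Measure X) [IsProbabilityMeasure μ] :
    ∀ᶠ d in Filter.atTop, μ (levelSet V d) ≠ 0 := by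
  have : ∃ N : ℕ, μ (levelSet V N) ≠ 0 := by
    by_contra! h
    have h1 : μ (⋃ N : ℕ, levelSet V N) = 0 := measure_iUnion_null h
    have h2 : ⋃ N : ℕ, levelSet V N = Set.univ := by
      refine Set.eq_univ_of_forall fun x => Set.mem_iUnion.2 ?_
      obtain ⟨N, hN⟩ := exists_nat_ge (V x)
      exact ⟨N, hN⟩
    simp [h2] at h1
  obtain ⟨N, hN⟩ := this
  filter_upwards [Filter.eventually_ge_atTop (N : ℝ)] with d hd
  exact fun h0 => hN (measure_mono_null (levelSet_mono V hd) h0)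

/-- The drift function `v = exp V`, with values in `[0, ∞]`. -/
noncomputable def expV {X : Type*} (V : X → ℝ) (x : X) : ENNReal := ENNReal.ofReal (Real.exp (V x))

lemma measurable_expV {V : X → ℝ} (hV : Measurable V) : Measurable (expV V) :=
  (Real.measurable_exp.comp hV).ennreal_ofReal

lemma Drift.lintegral_expV_le {F : FKModel X} {V : X → ℝ} {δ dlow : ℝ} {b : ℝ → ℝ}
    (hD : F.Drift V δ dlow b) {n : ℕ} (hn : 1 ≤ n) (x : X) :
    ∫⁻ y, expV V y ∂(F.Q n x) ≤ ENNReal.ofReal (Real.exp |b dlow|) * expV V x := by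
  refine (hD.drift dlow le_rfl n hn x).trans ?_
  rw [expV, ← ENNReal.ofReal_mul (Real.exp_pos _).le, ← Real.exp_add]
  refine ENNReal.ofReal_le_ofReal (Real.exp_le_exp.2 ?_)
  have h1 : 0 ≤ δ * V x := mul_nonneg hD.delta_pos.le (zero_le_one.trans (hD.one_le_V x))
  have h2 : b dlow * (levelSet V dlow).indicator (fun _ => (1 : ℝ)) x ≤ |b dlow| := by
    by_cases hx : x ∈ levelSet V dlow
    · simpa [hx] using le_abs_self _
    · simp [hx]
  linarith

/-- Only the drift inequality at `dlow` is used, so the constant `b dlow` stays fixed while `d`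
grows and the factor can be made arbitrarily small. With `b d` in its place nothing would follow, as
`b d` may grow with `d`. -/
lemma Drift.lintegral_expV_le_of_notMem {F : FKModel X} {V : X → ℝ} {δ dlow : ℝ} {b : ℝ → ℝ}
    (hD : F.Drift V δ dlow b) {n : ℕ} (hn : 1 ≤ n) {d : ℝ} {x : X} (hx : x ∉ levelSet V d) :
    ∫⁻ y, expV V y ∂(F.Q n x) ≤ ENNReal.ofReal (Real.exp (|b dlow| - δ * d)) * expV V x := by
  refine (hD.drift dlow le_rfl n hn x).trans ?_
  rw [expV, ← ENNReal.ofReal_mul (Real.exp_pos _).le, ← Real.exp_add]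
  refine ENNReal.ofReal_le_ofReal (Real.exp_le_exp.2 ?_)
  have h1 : δ * d ≤ δ * V x := mul_le_mul_of_nonneg_left (not_le.1 hx).le hD.delta_pos.le
  have h2 : b dlow * (levelSet V dlow).indicator (fun _ => (1 : ℝ)) x ≤ |b dlow| := by
    by_cases hx : x ∈ levelSet V dlow
    · simpa [hx] using le_abs_self _
    · simp [hx]
  linarith

lemma Minorization.le_Q {F : FKModel X} {V : X → ℝ} {dlow : ℝ} {εm : ℝ → ℝ} {ν : ℝ → Measure X}
    (hM : F.Minorization V dlow εm ν) (hV : Measurable V) {n : ℕ} (hn : 1 ≤ n) {d r : ℝ}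
    (hr : r ∈ Set.Icc dlow d) {x : X} (hx : x ∈ levelSet V d) :
    ENNReal.ofReal (εm d) * ν d (levelSet V r) ≤ F.Q n x (levelSet V r) := by
  have := hM.minor d (hr.1.trans hr.2) n hn x hx _ (measurableSet_levelSet hV r)
  rwa [Set.inter_eq_self_of_subset_right (levelSet_mono V hr.2)] at this

lemma Minorization.const_ne_zero {F : FKModel X} {V : X → ℝ} {dlow : ℝ} {εm : ℝ → ℝ}
    {ν : ℝ → Measure X} (hM : F.Minorization V dlow εm ν) {d r : ℝ} (hr : r ∈ Set.Icc dlow d) :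
    ENNReal.ofReal (εm d) * ν d (levelSet V r) ≠ 0 :=
  mul_ne_zero (ENNReal.ofReal_pos.2 (hM.eps_pos d (hr.1.trans hr.2))).ne'
    (hM.nu_pos d (hr.1.trans hr.2) r hr).ne'

/-- The mass of a level set is propagated by one step of the minorized dynamics. -/
lemma Minorization.mul_gamma_le {F : FKModel X} {V : X → ℝ} {dlow : ℝ} {εm : ℝ → ℝ}
    {ν : ℝ → Measure X} (hM : F.Minorization V dlow εm ν) (hV : Measurable V) (μ : Measure X)
    (n : ℕ) {d r : ℝ} (hr : r ∈ Set.Icc dlow d) :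
    ENNReal.ofReal (εm d) * ν d (levelSet V r) * F.gamma μ n (levelSet V d) ≤
      F.gamma μ (n + 1) (levelSet V r) := by
  rw [gamma_succ, Measure.bind_apply (measurableSet_levelSet hV r) (F.Q (n + 1)).aemeasurable,
    ← setLIntegral_const]
  exact (setLIntegral_mono' (measurableSet_levelSet hV d) fun x hx =>
    hM.le_Q hV n.succ_pos hr hx).trans (setLIntegral_le_lintegral _ _)

/-- Split according to `C_d`: outside it the drift contracts, inside it `v` is at most `exp d`. -/
lemma Drift.lintegral_gamma_succ_le {F : FKModel X} {V : X → ℝ} {δ dlow : ℝ} {b : ℝ → ℝ}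
    (hD : F.Drift V δ dlow b) (μ : Measure X) (n : ℕ) (d : ℝ) :
    ∫⁻ x, expV V x ∂(F.gamma μ (n + 1)) ≤
      ENNReal.ofReal (Real.exp (|b dlow| - δ * d)) * ∫⁻ x, expV V x ∂(F.gamma μ n) +
      ENNReal.ofReal (Real.exp |b dlow|) * ENNReal.ofReal (Real.exp d) *
        F.gamma μ n (levelSet V d) := by
  have hC := measurableSet_levelSet hD.measurable_V d
  have hv := measurable_expV hD.measurable_V
  rw [lintegral_gamma_succ F μ n hv, ← lintegral_add_compl _ hC, add_comm]
  refine add_le_add ?_ ?_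
  · rw [← lintegral_const_mul _ hv]
    exact (setLIntegral_mono' hC.compl fun x hx =>
      hD.lintegral_expV_le_of_notMem n.succ_pos hx).trans (setLIntegral_le_lintegral _ _)
  · rw [← setLIntegral_const]
    refine setLIntegral_mono' hC fun x hx => (hD.lintegral_expV_le n.succ_pos x).trans ?_
    gcongr
    exact ENNReal.ofReal_le_ofReal (Real.exp_le_exp.2 hx)

/-! ### Uniform moments and uniform lower bounds on the increments. -/

/-- The weighted masses `η_n(v)` are bounded, uniformly in time and over all models. -/
lemma exists_lintegral_expV_eta_le {μ : Measure X} {V : X → ℝ} {δ dlow : ℝ} {b εm : ℝ → ℝ}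
    {ν : ℝ → Measure X} {F₀ : FKModel X} (hμ : MemPv V μ)
    (hD₀ : F₀.Drift V δ dlow b) (hM₀ : F₀.Minorization V dlow εm ν) :
    ∃ Y : ENNReal, Y ≠ ⊤ ∧ ∀ F : FKModel X, F.Drift V δ dlow b → F.Minorization V dlow εm ν →
      (∀ n, IsFiniteKernel (F.Q n)) → ∀ n, ∫⁻ x, expV V x ∂(F.eta μ n) ≤ Y := by
  have := hμ.1
  have hνfin : ∀ d, dlow ≤ d → ∀ s, ν d s ≠ ⊤ := fun d hd s => by
    have := (hM₀.nu_mem d hd).1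
    exact measure_ne_top _ _
  set g : ENNReal := ENNReal.ofReal (εm dlow) * ν dlow (levelSet V dlow) with hg
  have hg0 : g ≠ 0 := hM₀.const_ne_zero ⟨le_rfl, le_rfl⟩
  have hg2 : g / 2 ≠ 0 := by simp [ENNReal.div_eq_zero_iff, hg0]
  -- The level `d` is large enough for `μ` to charge `C_d`, which starts the induction, and for the
  -- contraction factor outside `C_d` to be at most half of `g`, the factor by which the mass of
  -- `C_dlow` is propagated.
  obtain ⟨d, hd, hμd, hκ⟩ := ((Filter.eventually_ge_atTop dlow).and
    ((eventually_measure_levelSet_ne_zero V μ).and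
      (eventually_ofReal_exp_le hD₀.delta_pos |b dlow| hg2))).exists
  have hr : dlow ∈ Set.Icc dlow d := ⟨le_rfl, hd⟩
  set κ : ENNReal := ENNReal.ofReal (Real.exp (|b dlow| - δ * d)) with hκdef
  set c : ENNReal := ENNReal.ofReal (εm d) * ν d (levelSet V dlow) with hc
  have hc0 : c ≠ 0 := hM₀.const_ne_zero hr
  have hct : c ≠ ⊤ := ENNReal.mul_ne_top ENNReal.ofReal_ne_top (hνfin _ hd _)
  set E : ENNReal := ENNReal.ofReal (Real.exp |b dlow|) * ENNReal.ofReal (Real.exp d) with hE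
  set m : ENNReal := μ (levelSet V d) with hm
  have hmt : m ≠ ⊤ := measure_ne_top _ _
  set a : ENNReal := ∫⁻ x, expV V x ∂μ with ha
  have hat : a ≠ ⊤ := hμ.2.ne
  set B : ENNReal := E * c⁻¹ with hB
  -- The term `2 * B` absorbs the contribution of `C_d` at each step; the other term pays for the
  -- initial step from `μ`.
  set Y : ENNReal := 2 * B + κ * a * (c * m)⁻¹ with hY
  have hBt : B ≠ ⊤ := ENNReal.mul_ne_top (by simp [hE, ENNReal.mul_eq_top]) (by simpa using hc0)
  have hYt : Y ≠ ⊤ := by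
    have h1 : (c * m)⁻¹ ≠ ⊤ := by simpa using ⟨hc0, hμd⟩
    have h2 : κ ≠ ⊤ := ENNReal.ofReal_ne_top
    exact ENNReal.add_ne_top.2 ⟨ENNReal.mul_ne_top (by simp) hBt,
      ENNReal.mul_ne_top (ENNReal.mul_ne_top h2 hat) h1⟩
  refine ⟨Y + a, ENNReal.add_ne_top.2 ⟨hYt, hat⟩, fun F hD hM hQ n => ?_⟩
  have hV := hD.measurable_V
  have hEβ : ∀ n, E * F.gamma μ n (levelSet V d) ≤ B * F.gamma μ (n + 1) (levelSet V dlow) := by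
    intro n
    calc E * F.gamma μ n (levelSet V d)
        = E * c⁻¹ * (c * F.gamma μ n (levelSet V d)) := by
          rw [mul_assoc E, ENNReal.inv_mul_cancel_left hc0 hct]
      _ ≤ _ := by gcongr; exact hM.mul_gamma_le hV μ n hr
  -- The comparison with the mass of `C_dlow` starts at time one, because `μ` itself may not charge
  -- `C_dlow`. At each step the two halves of `Y` absorb the contracted part and the part coming
  -- from `C_d`.
  have key : ∀ n, ∫⁻ x, expV V x ∂(F.gamma μ (n + 1)) ≤
      Y * F.gamma μ (n + 1) (levelSet V dlow) := by
    intro n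
    induction n with
    | zero =>
      refine (hD.lintegral_gamma_succ_le μ 0 d).trans ?_
      have h1 := hM.mul_gamma_le hV μ 0 hr
      rw [gamma_zero] at h1 ⊢
      have hcm0 : c * m ≠ 0 := mul_ne_zero hc0 hμd
      have hcmt : c * m ≠ ⊤ := ENNReal.mul_ne_top hct hmt
      have h2 := hEβ 0
      rw [gamma_zero] at h2
      calc κ * a + E * m ≤ κ * a * (c * m)⁻¹ * (c * m) + B * F.gamma μ (0 + 1) (levelSet V dlow) := by
            rw [mul_assoc (κ * a), ENNReal.inv_mul_cancel hcm0 hcmt, mul_one]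
            gcongr
        _ ≤ κ * a * (c * m)⁻¹ * F.gamma μ (0 + 1) (levelSet V dlow) +
              B * F.gamma μ (0 + 1) (levelSet V dlow) := by gcongr
        _ ≤ Y * F.gamma μ (0 + 1) (levelSet V dlow) := by
            rw [← add_mul, hY, two_mul, add_comm]
            gcongr
            exact le_self_add
    | succ n ih =>
      refine (hD.lintegral_gamma_succ_le μ (n + 1) d).trans ?_
      have h1 := hM.mul_gamma_le hV μ (n + 1) (d := dlow) (r := dlow) ⟨le_rfl, le_rfl⟩
      have h3 : 2 * B ≤ Y := le_self_add
      calc κ * ∫⁻ x, expV V x ∂(F.gamma μ (n + 1)) + E * F.gamma μ (n + 1) (levelSet V d)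
          ≤ g / 2 * (Y * F.gamma μ (n + 1) (levelSet V dlow)) +
              B * F.gamma μ (n + 1 + 1) (levelSet V dlow) := by
            exact add_le_add (by gcongr) (hEβ (n + 1))
        _ = Y / 2 * (g * F.gamma μ (n + 1) (levelSet V dlow)) +
              B * F.gamma μ (n + 1 + 1) (levelSet V dlow) := by
            simp only [div_eq_mul_inv]; ring
        _ ≤ Y / 2 * F.gamma μ (n + 1 + 1) (levelSet V dlow) +
              Y / 2 * F.gamma μ (n + 1 + 1) (levelSet V dlow) := by
            gcongr
            rw [ENNReal.le_div_iff_mul_le (by simp) (by simp), mul_comm]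
            exact h3
        _ = Y * F.gamma μ (n + 1 + 1) (levelSet V dlow) := by
            rw [← add_mul, ENNReal.add_halves]
  rw [lintegral_eta]
  cases n with
  | zero => simp [gamma_zero, ha]
  | succ n =>
    have := gamma_isFiniteMeasure hQ μ (n + 1)
    calc _ ≤ (F.gamma μ (n + 1) Set.univ)⁻¹ * (Y * F.gamma μ (n + 1) Set.univ) := by
          gcongr
          exact (key n).trans (mul_le_mul_right (measure_mono (Set.subset_univ _)) Y)
      _ = Y := by
          rw [mul_left_comm, ENNReal.inv_mul_cancel (F.gamma_univ_ne_zero μ _)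
            (measure_ne_top _ _), mul_one]
      _ ≤ Y + a := le_self_add

/-- Markov's inequality for `exp V`; the level depends on the measure only through the bound `Y`. -/
lemma eventually_half_le_levelSet {V : X → ℝ} (hV : Measurable V) {Y : ENNReal} (hY : Y ≠ ⊤) :
    ∀ᶠ d in Filter.atTop, ∀ η : Measure X, IsProbabilityMeasure η → ∫⁻ x, expV V x ∂η ≤ Y →
      1 / 2 ≤ η (levelSet V d) := by
  have hc : (2 * (Y + 1))⁻¹ ≠ 0 := by
    simp [ENNReal.mul_eq_top, hY]
  filter_upwards [eventually_ofReal_exp_le one_pos 0 hc] with d hd η hη hYη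
  have hC := measurableSet_levelSet hV d
  have h1 : η (levelSet V d)ᶜ ≤ 1 / 2 := by
    have h2 : ENNReal.ofReal (Real.exp d) * η (levelSet V d)ᶜ ≤ Y := by
      rw [← setLIntegral_const]
      refine (setLIntegral_mono' hC.compl fun x hx => ?_).trans
        ((setLIntegral_le_lintegral _ _).trans hYη)
      exact ENNReal.ofReal_le_ofReal (Real.exp_le_exp.2 (not_le.1 (show ¬ V x ≤ d from hx)).le)
    have h3 : ENNReal.ofReal (Real.exp (0 - 1 * d)) * ENNReal.ofReal (Real.exp d) = 1 := by
      rw [← ENNReal.ofReal_mul (Real.exp_pos _).le, ← Real.exp_add]; simp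
    calc η (levelSet V d)ᶜ = ENNReal.ofReal (Real.exp (0 - 1 * d)) *
          (ENNReal.ofReal (Real.exp d) * η (levelSet V d)ᶜ) := by rw [← mul_assoc, h3, one_mul]
      _ ≤ (2 * (Y + 1))⁻¹ * (Y + 1) := by gcongr; exact h2.trans le_self_add
      _ = 1 / 2 := by
        rw [ENNReal.mul_inv (by simp) (by simp), mul_assoc,
          ENNReal.inv_mul_cancel (by simp) (by simpa using hY), mul_one, one_div]
  rw [← compl_compl (levelSet V d), prob_compl_eq_one_sub hC.compl]
  calc (1 : ENNReal) / 2 = 1 - 1 / 2 := by simp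
    _ ≤ _ := tsub_le_tsub_left h1 1

/-- A uniform lower bound for the normalizing increments, from the mass of a level set. -/
lemma Minorization.le_evid_succ {F : FKModel X} {V : X → ℝ} {dlow : ℝ} {εm : ℝ → ℝ}
    {ν : ℝ → Measure X} (hM : F.Minorization V dlow εm ν) (hV : Measurable V) (μ : Measure X)
    {d : ℝ} (hd : dlow ≤ d) (p : ℕ) (hp : 1 / 2 ≤ F.eta μ p (levelSet V d)) :
    ENNReal.ofReal (εm d) * ν d (levelSet V d) * (1 / 2) ≤ F.evid μ p (p + 1) := by
  have hC := measurableSet_levelSet hV d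
  calc _ ≤ ENNReal.ofReal (εm d) * ν d (levelSet V d) * F.eta μ p (levelSet V d) := by gcongr
    _ ≤ ∫⁻ x in levelSet V d, F.Q (p + 1) x Set.univ ∂(F.eta μ p) := by
      rw [← setLIntegral_const]
      exact setLIntegral_mono' hC fun x hx =>
        (hM.le_Q hV p.succ_pos ⟨hd, le_rfl⟩ hx).trans (measure_mono (Set.subset_univ _))
    _ ≤ F.evid μ p (p + 1) := by
      rw [evid_succ]
      simp only [Q_univ, Nat.add_sub_cancel]
      exact setLIntegral_le_lintegral _ _

/-! ### Domination of the normalized masses by the weight. -/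

/-- One-step estimates on the semigroup, in terms of a weight `w` and a set `C`: `K` controls the
growth of `w` everywhere, `κ` controls it outside `C`, and on `C` the kernels restricted to `C` are
comparable, within a factor `A`, to a common measure `m`. -/
structure StepBounds (F : FKModel X) (C : Set X) (w : X → ENNReal) (K κ A : ENNReal)
    (m : Measure X) : Prop where
  finite_Q : ∀ n, IsFiniteKernel (F.Q n)
  measurableSet_C : MeasurableSet C
  measurable_w : Measurable w
  one_le_w : ∀ x, 1 ≤ w x
  growth : ∀ n, 1 ≤ n → ∀ x, ∫⁻ y, w y ∂(F.Q n x) ≤ K * w x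
  growth_off : ∀ n, 1 ≤ n → ∀ x, x ∉ C → ∫⁻ y, w y ∂(F.Q n x) ≤ κ * w x
  finite_m : IsFiniteMeasure m
  A_ne_top : A ≠ ⊤
  lower : ∀ n, 1 ≤ n → ∀ x ∈ C, m ≤ (F.Q n x).restrict C
  upper : ∀ n, 1 ≤ n → ∀ x ∈ C, (F.Q n x).restrict C ≤ A • m

namespace StepBounds

variable {F : FKModel X} {C : Set X} {w : X → ENNReal} {K κ A : ENNReal} {m : Measure X}

lemma setLIntegral_le (hS : F.StepBounds C w K κ A m) {n : ℕ} (hn : 1 ≤ n) {x y : X} (hx : x ∈ C)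
    (hy : y ∈ C) (g : X → ENNReal) :
    ∫⁻ z in C, g z ∂(F.Q n x) ≤ A * ∫⁻ z in C, g z ∂(F.Q n y) :=
  calc ∫⁻ z in C, g z ∂(F.Q n x) ≤ ∫⁻ z, g z ∂(A • m) :=
        lintegral_mono' (hS.upper n hn x hx) le_rfl
    _ = A * ∫⁻ z, g z ∂m := by rw [lintegral_smul_measure, smul_eq_mul]
    _ ≤ _ := by gcongr; exact hS.lower n hn y hy

open scoped Classical in
/-- The total masses, normalized, are dominated by the weight uniformly in time. -/
lemma mass_le_piecewise (hS : F.StepBounds C w K κ A m) (hA : 1 ≤ A) (μ : Measure X)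
    [IsProbabilityMeasure μ] {l σ : ENNReal}
    (hl : ∀ p, l ≤ F.evid μ p (p + 1)) (hσ1 : 1 ≤ σ) (hσ : 2 * K ≤ σ * l) (hσκ : σ * κ ≤ l)
    (hη : ∀ p, 1 / 2 ≤ F.eta μ p C) (k p : ℕ) (x : X) :
    F.mass p (p + k) x ≤ 4 * A * (if x ∈ C then σ * w x else w x) * F.evid μ p (p + k) := by
  have hC := hS.measurableSet_C
  induction k generalizing p x with
  | zero =>
    have h1 : 1 ≤ if x ∈ C then σ * w x else w x := by
      split_ifs
      · exact one_le_mul hσ1 (hS.one_le_w x)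
      · exact hS.one_le_w x
    have h4 : (1 : ENNReal) ≤ 4 := by norm_num
    simpa [mass_self, evid_self hS.finite_Q] using one_le_mul (one_le_mul h4 hA) h1
  | succ k ih =>
    have hlt : p < p + (k + 1) := by omega
    have hEq : p + 1 + k = p + (k + 1) := by omega
    have ih := ih (p + 1)
    rw [hEq] at ih
    set n := p + (k + 1) with hn
    set Z := F.evid μ p n with hZ
    set Z' := F.evid μ (p + 1) n with hZ'
    have hlZ : l * Z' ≤ Z := by
      rw [hZ, evid_mul hS.finite_Q μ p.le_succ hlt]
      exact mul_le_mul_left (hl p) Z'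
    -- Inside `C`, the part of the step that stays in `C` is comparable, up to `A`, with the same
    -- quantity from any other point of `C`; averaging over `η_p`, which gives `C` mass at least one
    -- half, bounds it by `2 * A * Z`. The part that leaves `C` meets the weight without the factor
    -- `σ`, and `2 * K ≤ σ * l` absorbs the growth.
    by_cases hx : x ∈ C
    · rw [if_pos hx, mass_succ_left F hlt, ← lintegral_add_compl _ hC]
      have h1 : ∫⁻ y in C, F.mass (p + 1) n y ∂(F.Q (p + 1) x) ≤ 2 * A * Z := by
        have h2 : (∫⁻ y in C, F.mass (p + 1) n y ∂(F.Q (p + 1) x)) * F.eta μ p C ≤ A * Z := by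
          rw [← setLIntegral_const, hZ, evid, ← lintegral_const_mul _ (F.measurable_mass p n)]
          refine (setLIntegral_mono' hC fun y hy => ?_).trans (setLIntegral_le_lintegral _ _)
          refine (hS.setLIntegral_le p.succ_pos hx hy _).trans ?_
          rw [mass_succ_left F hlt]
          exact mul_le_mul_right (setLIntegral_le_lintegral _ _) A
        calc ∫⁻ y in C, F.mass (p + 1) n y ∂(F.Q (p + 1) x)
            = 2 * ((∫⁻ y in C, F.mass (p + 1) n y ∂(F.Q (p + 1) x)) * (1 / 2)) := by
              rw [mul_left_comm, one_div, ENNReal.mul_inv_cancel (by simp) (by simp), mul_one]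
          _ ≤ 2 * ((∫⁻ y in C, F.mass (p + 1) n y ∂(F.Q (p + 1) x)) * F.eta μ p C) := by
              gcongr; exact hη p
          _ ≤ 2 * (A * Z) := by gcongr
          _ = 2 * A * Z := by ring
      have h2 : ∫⁻ y in Cᶜ, F.mass (p + 1) n y ∂(F.Q (p + 1) x) ≤ 2 * A * (σ * w x) * Z :=
        calc _ ≤ ∫⁻ y in Cᶜ, 4 * A * Z' * w y ∂(F.Q (p + 1) x) :=
              setLIntegral_mono' hC.compl fun y hy => by
                refine (ih y).trans ?_
                rw [if_neg hy, mul_right_comm]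
          _ ≤ ∫⁻ y, 4 * A * Z' * w y ∂(F.Q (p + 1) x) := setLIntegral_le_lintegral _ _
          _ ≤ 4 * A * Z' * (K * w x) := by
              rw [lintegral_const_mul _ hS.measurable_w]
              gcongr
              exact hS.growth _ p.succ_pos x
          _ = 2 * A * w x * Z' * (2 * K) := by ring
          _ ≤ 2 * A * w x * Z' * (σ * l) := by gcongr
          _ = 2 * A * (σ * w x) * (l * Z') := by ring
          _ ≤ 2 * A * (σ * w x) * Z := by gcongr
      have h3 : 1 ≤ σ * w x := one_le_mul hσ1 (hS.one_le_w x)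
      calc _ ≤ 2 * A * 1 * Z + 2 * A * (σ * w x) * Z := by
            rw [mul_one]; exact add_le_add h1 h2
        _ ≤ 2 * A * (σ * w x) * Z + 2 * A * (σ * w x) * Z := by gcongr
        _ = 4 * A * (σ * w x) * Z := by ring
    -- Outside `C` the next point may enter `C` and pick up the factor `σ`; the small drift factor
    -- pays for it through `σ * κ ≤ l`.
    · rw [if_neg hx, mass_succ_left F hlt]
      calc _ ≤ ∫⁻ y, 4 * A * Z' * σ * w y ∂(F.Q (p + 1) x) := lintegral_mono fun y => by
            refine (ih y).trans ?_
            have h1 : (if y ∈ C then σ * w y else w y) ≤ σ * w y := by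
              split_ifs
              · exact le_rfl
              · exact le_mul_of_one_le_left' hσ1
            calc _ ≤ 4 * A * (σ * w y) * Z' := by gcongr
              _ = _ := by ring
        _ ≤ 4 * A * Z' * σ * (κ * w x) := by
            rw [lintegral_const_mul _ hS.measurable_w]
            gcongr
            exact hS.growth_off _ p.succ_pos x hx
        _ = 4 * A * w x * Z' * (σ * κ) := by ring
        _ ≤ 4 * A * w x * Z' * l := by gcongr
        _ = 4 * A * w x * (l * Z') := by ring
        _ ≤ 4 * A * w x * Z := by gcongr

lemma mass_le (hS : F.StepBounds C w K κ A m) (hA : 1 ≤ A) (μ : Measure X)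
    [IsProbabilityMeasure μ] {l σ : ENNReal}
    (hl : ∀ p, l ≤ F.evid μ p (p + 1)) (hσ1 : 1 ≤ σ) (hσ : 2 * K ≤ σ * l) (hσκ : σ * κ ≤ l)
    (hη : ∀ p, 1 / 2 ≤ F.eta μ p C) {p n : ℕ} (hpn : p ≤ n) (x : X) :
    F.mass p n x ≤ 4 * A * σ * w x * F.evid μ p n := by
  classical
  obtain ⟨k, rfl⟩ := Nat.exists_eq_add_of_le hpn
  refine (hS.mass_le_piecewise hA μ hl hσ1 hσ hσκ hη k p x).trans ?_
  rw [mul_assoc (4 * A) σ]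
  gcongr
  split_ifs
  · exact le_rfl
  · exact le_mul_of_one_le_left' hσ1

end StepBounds

end FKModel

/-! ### Contraction for antisymmetric functions of a pair. -/

/-- Contraction from a minorizing measure that annihilates the integrand. -/
lemma enorm_integral_le_of_minorized {Ω : Type*} [MeasurableSpace Ω] {q s : Measure Ω}
    [IsFiniteMeasure q] {C : Set Ω} (hC : MeasurableSet C) {ε : ENNReal} (hε : ε ≤ 1) (hsq : s ≤ q)
    (hs : ε • q.restrict C ≤ s) {f : Ω → ℝ} (hf : Integrable f q) (hf0 : ∫ x, f x ∂s = 0) :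
    ‖∫ x, f x ∂q‖ₑ ≤ (1 - ε) * ∫⁻ x in C, ‖f x‖ₑ ∂q + ∫⁻ x in Cᶜ, ‖f x‖ₑ ∂q := by
  have : IsFiniteMeasure s := isFiniteMeasure_of_le q hsq
  have hadd : q - s + s = q := Measure.sub_add_cancel_of_le hsq
  -- Since `s` annihilates `f`, only the remainder `q - s` counts: on `C` it has lost the fraction
  -- `ε` of `q`, elsewhere it is at most `q`.
  have hle : q - s ≤ (1 - ε) • q.restrict C + q.restrict Cᶜ := by
    refine Measure.le_iff.2 fun B hB => ?_
    rw [Measure.sub_apply hB hsq, tsub_le_iff_right]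
    have h1 : q B = q.restrict C B + q.restrict Cᶜ B := by
      rw [← Measure.add_apply, Measure.restrict_add_restrict_compl hC]
    have h2 := hs B
    rw [Measure.smul_apply, smul_eq_mul] at h2
    rw [h1, Measure.add_apply, Measure.smul_apply, smul_eq_mul, add_right_comm]
    gcongr
    calc q.restrict C B = (1 - ε) * q.restrict C B + ε * q.restrict C B := by
          rw [← add_mul, tsub_add_cancel_of_le hε, one_mul]
      _ ≤ _ := by gcongr
  have hint : ∫ x, f x ∂q = ∫ x, f x ∂(q - s) := by
    conv_lhs => rw [← hadd]
    rw [integral_add_measure (hf.mono_measure Measure.sub_le) (hf.mono_measure hsq), hf0, add_zero]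
  rw [hint]
  refine (enorm_integral_le_lintegral_enorm _).trans ((lintegral_mono' hle le_rfl).trans ?_)
  rw [lintegral_add_measure, lintegral_smul_measure, smul_eq_mul]

lemma integral_eq_zero_of_antisymm {X : Type*} [MeasurableSpace X] (m : Measure X) [SFinite m]
    {f : X × X → ℝ} (hf : ∀ z, f z.swap = -f z) : ∫ z, f z ∂(m.prod m) = 0 := by
  have h := integral_prod_swap (μ := m) (ν := m) f
  simp only [hf, integral_neg] at h
  linarith

namespace FKModel

variable {X : Type*} [MeasurableSpace X]

/-- The antisymmetric function `Q_{p,n}φ(a) Q_{p,n}1(b) - Q_{p,n}1(a) Q_{p,n}φ(b)`. -/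
noncomputable def pairDiff (F : FKModel X) (φ : X → ℝ) (p n : ℕ) (z : X × X) : ℝ :=
  (∫ y, φ y ∂(F.Qsemi p n z.1)) * (F.mass p n z.2).toReal -
    (F.mass p n z.1).toReal * ∫ y, φ y ∂(F.Qsemi p n z.2)

lemma pairDiff_swap (F : FKModel X) (φ : X → ℝ) (p n : ℕ) (z : X × X) :
    F.pairDiff φ p n z.swap = -F.pairDiff φ p n z := by
  simp only [pairDiff, Prod.fst_swap, Prod.snd_swap]; ring

lemma integrable_of_bounded {φ : X → ℝ} (hφ : Measurable φ) {B : ℝ} (hB : ∀ x, |φ x| ≤ B)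
    (m : Measure X) [IsFiniteMeasure m] : Integrable φ m :=
  Integrable.of_bound hφ.aestronglyMeasurable B (Filter.Eventually.of_forall hB)

lemma mass_toReal (F : FKModel X) (p n : ℕ) (x : X) :
    (F.mass p n x).toReal = ∫ _, (1 : ℝ) ∂(F.Qsemi p n x) := by
  simp [mass, Measure.real]

section Recursion

variable {F : FKModel X} (hQ : ∀ n, IsFiniteKernel (F.Q n)) {φ : X → ℝ} (hφ : Measurable φ) {B : ℝ}
  (hB : ∀ x, |φ x| ≤ B)
include hQ hφ hB

lemma integrable_integral_Qsemi (p n : ℕ) (a : X) :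
    Integrable (fun x => ∫ y, φ y ∂(F.Qsemi (p + 1) n x)) (F.Q (p + 1) a) := by
  have := Qsemi_isFiniteKernel hQ (p + 1) n
  have := hQ (p + 1)
  exact (integrable_of_bounded hφ hB ((F.Qsemi (p + 1) n ∘ₖ F.Q (p + 1)) a)).integral_comp

lemma integral_Qsemi_succ_left {p n : ℕ} (hpn : p < n) (a : X) :
    ∫ y, φ y ∂(F.Qsemi p n a) = ∫ x, ∫ y, φ y ∂(F.Qsemi (p + 1) n x) ∂(F.Q (p + 1) a) := by
  have := Qsemi_isFiniteKernel hQ (p + 1) n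
  have := hQ (p + 1)
  rw [Qsemi_succ_left F hpn, Kernel.integral_comp (integrable_of_bounded hφ hB _)]

lemma integrable_pairDiff (p n : ℕ) (a b : X) :
    Integrable (F.pairDiff φ (p + 1) n) ((F.Q (p + 1) a).prod (F.Q (p + 1) b)) := by
  have := hQ (p + 1)
  have h1 : ∀ a, Integrable (fun x => (F.mass (p + 1) n x).toReal) (F.Q (p + 1) a) := fun a => by
    simp only [mass_toReal]
    exact integrable_integral_Qsemi (B := 1) hQ measurable_const (by simp) p n a
  have h2 := integrable_integral_Qsemi hQ hφ hB p n
  exact ((h2 a).mul_prod (h1 b)).sub ((h1 a).mul_prod (h2 b))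

/-- The tensor square of the semigroup acts on `φ ⊗ 1 - 1 ⊗ φ`, and one step of it is peeled off on
the left. -/
lemma pairDiff_succ_left {p n : ℕ} (hpn : p < n) (a b : X) :
    F.pairDiff φ p n (a, b) =
      ∫ z, F.pairDiff φ (p + 1) n z ∂((F.Q (p + 1) a).prod (F.Q (p + 1) b)) := by
  have := hQ (p + 1)
  have h1 : ∀ a, Integrable (fun x => (F.mass (p + 1) n x).toReal) (F.Q (p + 1) a) := fun a => by
    simp only [mass_toReal]
    exact integrable_integral_Qsemi (B := 1) hQ measurable_const (by simp) p n a
  have h2 := integrable_integral_Qsemi hQ hφ hB p n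
  have h3 : ∀ a, (F.mass p n a).toReal = ∫ x, (F.mass (p + 1) n x).toReal ∂(F.Q (p + 1) a) := by
    intro a
    simp only [mass_toReal]
    exact integral_Qsemi_succ_left (B := 1) hQ measurable_const (by simp) hpn a
  simp only [pairDiff]
  rw [integral_sub ((h2 a).mul_prod (h1 b)) ((h1 a).mul_prod (h2 b)),
    integral_prod_mul (fun x => ∫ y, φ y ∂(F.Qsemi (p + 1) n x))
      (fun x => (F.mass (p + 1) n x).toReal),
    integral_prod_mul (fun x => (F.mass (p + 1) n x).toReal)
      (fun x => ∫ y, φ y ∂(F.Qsemi (p + 1) n x)), h3, h3, integral_Qsemi_succ_left hQ hφ hB hpn,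
    integral_Qsemi_succ_left hQ hφ hB hpn]

end Recursion

/-- The geometric interpolation `w^θ Q_{p,n}(1)^{1-θ}`. -/
noncomputable def interp (F : FKModel X) (w : X → ENNReal) (θ : ℝ) (p n : ℕ) (x : X) : ENNReal :=
  w x ^ θ * F.mass p n x ^ (1 - θ)

namespace StepBounds

variable {F : FKModel X} {C : Set X} {w : X → ENNReal} {K κ A : ENNReal} {m : Measure X}

lemma measurable_interp (hS : F.StepBounds C w K κ A m) (θ : ℝ) (p n : ℕ) :
    Measurable (F.interp w θ p n) :=
  (hS.measurable_w.pow_const _).mul ((F.measurable_mass p n).pow_const _)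

/-- Hölder with exponents `θ` and `1 - θ`: the mass factor reproduces itself exactly, so only `w ^
θ` incurs a growth cost. -/
lemma lintegral_interp_le (hS : F.StepBounds C w K κ A m) {θ : ℝ} (hθ0 : 0 ≤ θ) (hθ1 : θ ≤ 1)
    {p n : ℕ} (hpn : p < n) (x : X) :
    ∫⁻ y, F.interp w θ (p + 1) n y ∂(F.Q (p + 1) x) ≤
      (∫⁻ y, w y ∂(F.Q (p + 1) x)) ^ θ * F.mass p n x ^ (1 - θ) := by
  rw [mass_succ_left F hpn]
  exact ENNReal.lintegral_mul_norm_pow_le hS.measurable_w.aemeasurable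
    (F.measurable_mass _ _).aemeasurable hθ0 (by linarith) (by ring)

open scoped Classical in
/-- The coupling weight: `1` on `C × C`, and `ρ⁻¹` elsewhere. -/
noncomputable def couplingWeight {X : Type*} (C : Set X) (ρ : ENNReal) (z : X × X) : ENNReal :=
  if z ∈ C ×ˢ C then 1 else ρ⁻¹

lemma one_le_couplingWeight {X : Type*} (C : Set X) {ρ : ENNReal} (hρ : ρ ≤ 1) (z : X × X) :
    1 ≤ couplingWeight C ρ z := by
  unfold couplingWeight
  split_ifs
  · exact le_rfl
  · exact ENNReal.one_le_inv.2 hρ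

/-- From `C × C`, the minorizing `m ⊗ m` kills the antisymmetric function and leaves at most `ρ` of
the mass landing in `C × C`; mass landing elsewhere is not contracted, but carries weight `ρ⁻¹`, so
the factor `ρ` is still available. From outside `C × C` the claimed factor is `ρ * ρ⁻¹ = 1` and
there is nothing to gain. -/
lemma enorm_pairDiff_le_lintegral (hS : F.StepBounds C w K κ A m) (hA : 1 ≤ A) {ρ : ENNReal}
    (hρ0 : ρ ≠ 0) (hρ1 : ρ ≤ 1) (hAρ : 1 - (A * A)⁻¹ ≤ ρ) {φ : X → ℝ} (hφ : Measurable φ) {B : ℝ}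
    (hB : ∀ x, |φ x| ≤ B) {p n : ℕ} (hpn : p < n) (a b : X) :
    ‖F.pairDiff φ p n (a, b)‖ₑ ≤ ρ * couplingWeight C ρ (a, b) *
      ∫⁻ z, couplingWeight C ρ z * ‖F.pairDiff φ (p + 1) n z‖ₑ
        ∂((F.Q (p + 1) a).prod (F.Q (p + 1) b)) := by
  have := hS.finite_Q (p + 1)
  have := hS.finite_m
  have hρt : ρ ≠ ⊤ := ne_top_of_le_ne_top ENNReal.one_ne_top hρ1
  have hCC := hS.measurableSet_C.prod hS.measurableSet_C
  rw [pairDiff_succ_left hS.finite_Q hφ hB hpn]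
  by_cases hab : (a, b) ∈ C ×ˢ C
  · set q := (F.Q (p + 1) a).prod (F.Q (p + 1) b) with hq
    set g := F.pairDiff φ (p + 1) n
    have hlow : m.prod m ≤ q :=
      Measure.prod_mono ((hS.lower _ p.succ_pos a hab.1).trans Measure.restrict_le_self)
        ((hS.lower _ p.succ_pos b hab.2).trans Measure.restrict_le_self)
    have hup : (A * A)⁻¹ • q.restrict (C ×ˢ C) ≤ m.prod m := by
      have hAm : IsFiniteMeasure (A • m) := by
        refine ⟨?_⟩
        rw [Measure.smul_apply, smul_eq_mul]
        exact ENNReal.mul_lt_top hS.A_ne_top.lt_top (measure_lt_top _ _)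
      have h1 : q.restrict (C ×ˢ C) ≤ (A * A) • m.prod m := by
        rw [hq, ← Measure.prod_restrict, mul_smul, ← Measure.prod_smul_right,
          ← Measure.prod_smul_left]
        exact Measure.prod_mono (hS.upper _ p.succ_pos a hab.1) (hS.upper _ p.succ_pos b hab.2)
      refine Measure.le_iff.2 fun s _ => ?_
      have h2 := h1 s
      rw [Measure.smul_apply, smul_eq_mul] at h2 ⊢
      have h0 : A * A ≠ 0 := (one_le_mul hA hA).trans_lt' zero_lt_one |>.ne'
      have ht : A * A ≠ ⊤ := ENNReal.mul_ne_top hS.A_ne_top hS.A_ne_top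
      calc _ ≤ (A * A)⁻¹ * (A * A * m.prod m s) := by gcongr
        _ = _ := ENNReal.inv_mul_cancel_left h0 ht
    refine (enorm_integral_le_of_minorized hCC (ENNReal.inv_le_one.2 (one_le_mul hA hA)) hlow hup
      (integrable_pairDiff hS.finite_Q hφ hB p n a b)
      (integral_eq_zero_of_antisymm m (F.pairDiff_swap φ (p + 1) n))).trans ?_
    rw [couplingWeight, if_pos hab, mul_one,
      ← lintegral_add_compl (fun z => couplingWeight C ρ z * ‖g z‖ₑ) hCC, mul_add]
    refine add_le_add (mul_le_mul' hAρ ?_) ?_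
    · exact lintegral_mono fun z => le_mul_of_one_le_left' (one_le_couplingWeight C hρ1 z)
    · rw [← lintegral_const_mul' _ _ hρt]
      refine setLIntegral_mono' hCC.compl fun z hz => ?_
      rw [couplingWeight, if_neg hz, ENNReal.mul_inv_cancel_left hρ0 hρt]
  · rw [couplingWeight, if_neg hab, ENNReal.mul_inv_cancel hρ0 hρt, one_mul]
    exact (enorm_integral_le_lintegral_enorm _).trans
      (lintegral_mono fun z => le_mul_of_one_le_left' (one_le_couplingWeight C hρ1 z))

/-- Outside `C × C` at least one coordinate lies outside `C`; its drift factor `κ ^ θ ≤ ρ * ρ * K ^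
θ` alone repays the squared weight `ρ⁻¹ * ρ⁻¹`. -/
lemma couplingWeight_mul_le (hS : F.StepBounds C w K κ A m) {ρ : ENNReal} (hρ0 : ρ ≠ 0)
    (hρ1 : ρ ≤ 1) {θ : ℝ} (hθ0 : 0 ≤ θ) (hκ : κ ^ θ ≤ ρ * ρ * K ^ θ) {n : ℕ} (hn : 1 ≤ n)
    (a b : X) :
    couplingWeight C ρ (a, b) * couplingWeight C ρ (a, b) *
        ((∫⁻ y, w y ∂(F.Q n a)) ^ θ * (∫⁻ y, w y ∂(F.Q n b)) ^ θ) ≤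
      K ^ θ * K ^ θ * (w a ^ θ * w b ^ θ) := by
  have hρt : ρ ≠ ⊤ := ne_top_of_le_ne_top ENNReal.one_ne_top hρ1
  have h1 : ∀ x, (∫⁻ y, w y ∂(F.Q n x)) ^ θ ≤ K ^ θ * w x ^ θ := fun x => by
    rw [← ENNReal.mul_rpow_of_nonneg _ _ hθ0]
    exact ENNReal.rpow_le_rpow (hS.growth n hn x) hθ0
  have h2 : ∀ x, x ∉ C → ρ⁻¹ * ρ⁻¹ * (∫⁻ y, w y ∂(F.Q n x)) ^ θ ≤ K ^ θ * w x ^ θ := fun x hx => by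
    calc ρ⁻¹ * ρ⁻¹ * (∫⁻ y, w y ∂(F.Q n x)) ^ θ ≤ ρ⁻¹ * ρ⁻¹ * (κ ^ θ * w x ^ θ) := by
          gcongr
          rw [← ENNReal.mul_rpow_of_nonneg _ _ hθ0]
          exact ENNReal.rpow_le_rpow (hS.growth_off n hn x hx) hθ0
      _ ≤ ρ⁻¹ * ρ⁻¹ * (ρ * ρ * K ^ θ * w x ^ θ) := by gcongr
      _ = (ρ⁻¹ * ρ) * (ρ⁻¹ * ρ) * (K ^ θ * w x ^ θ) := by ring
      _ = K ^ θ * w x ^ θ := by rw [ENNReal.inv_mul_cancel hρ0 hρt, one_mul, one_mul]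
  have hR : K ^ θ * K ^ θ * (w a ^ θ * w b ^ θ) = (K ^ θ * w a ^ θ) * (K ^ θ * w b ^ θ) := by ring
  rw [hR, couplingWeight]
  split_ifs with hab
  · simpa using mul_le_mul' (h1 a) (h1 b)
  · by_cases ha : a ∈ C
    · have hb : b ∉ C := fun hb => hab ⟨ha, hb⟩
      calc _ = (∫⁻ y, w y ∂(F.Q n a)) ^ θ * (ρ⁻¹ * ρ⁻¹ * (∫⁻ y, w y ∂(F.Q n b)) ^ θ) := by ring
        _ ≤ _ := mul_le_mul' (h1 a) (h2 b hb)
    · rw [← mul_assoc]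
      exact mul_le_mul' (h2 a ha) (h1 b)

/-- The coupling weight is kept on the left so that the induction closes: it occurs once there and
once in the one-step bound, hence squared in `couplingWeight_mul_le`. -/
lemma couplingWeight_mul_enorm_pairDiff_le (hS : F.StepBounds C w K κ A m) (hA : 1 ≤ A)
    {ρ : ENNReal} (hρ0 : ρ ≠ 0) (hρ1 : ρ ≤ 1) (hAρ : 1 - (A * A)⁻¹ ≤ ρ) {θ : ℝ} (hθ0 : 0 < θ)
    (hθ1 : θ ≤ 1) (hκ : κ ^ θ ≤ ρ * ρ * K ^ θ) {φ : X → ℝ} (hφ : Measurable φ) {B : ℝ}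
    (hB : ∀ x, |φ x| ≤ B) (k p : ℕ) (a b : X) :
    couplingWeight C ρ (a, b) * ‖F.pairDiff φ p (p + k) (a, b)‖ₑ ≤
      2 * ENNReal.ofReal B * ρ⁻¹ * (ρ * (K ^ θ * K ^ θ)) ^ k *
        (F.interp w θ p (p + k) a * F.interp w θ p (p + k) b) := by
  induction k generalizing p a b with
  | zero =>
    have hw : ∀ x, 1 ≤ F.interp w θ p (p + 0) x := fun x => by
      simpa [interp, mass_self] using ENNReal.one_le_rpow (hS.one_le_w x) hθ0
    have h1 : ‖F.pairDiff φ p (p + 0) (a, b)‖ₑ ≤ 2 * ENNReal.ofReal B := by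
      simp only [pairDiff, add_zero, mass_self, Qsemi_self, Kernel.id_apply, ENNReal.toReal_one,
        mul_one, one_mul]
      rw [integral_dirac' _ _ hφ.stronglyMeasurable, integral_dirac' _ _ hφ.stronglyMeasurable]
      have hb : ∀ x, ‖φ x‖ₑ ≤ ENNReal.ofReal B := fun x => by
        rw [← ofReal_norm]; exact ENNReal.ofReal_le_ofReal (hB x)
      rw [two_mul]
      exact enorm_sub_le.trans (add_le_add (hb a) (hb b))
    have h2 : couplingWeight C ρ (a, b) ≤ ρ⁻¹ := by
      unfold couplingWeight
      split_ifs
      · exact ENNReal.one_le_inv.2 hρ1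
      · exact le_rfl
    calc _ ≤ ρ⁻¹ * (2 * ENNReal.ofReal B) := mul_le_mul' h2 h1
      _ = 2 * ENNReal.ofReal B * ρ⁻¹ * (ρ * (K ^ θ * K ^ θ)) ^ 0 * 1 := by
        rw [pow_zero]; ring
      _ ≤ _ := by gcongr; exact one_le_mul (hw a) (hw b)
  | succ k ih =>
    have hlt : p < p + (k + 1) := by omega
    have hEq : p + 1 + k = p + (k + 1) := by omega
    have ih := ih (p + 1)
    rw [hEq] at ih
    set n := p + (k + 1) with hn
    set D := 2 * ENNReal.ofReal B * ρ⁻¹ * (ρ * (K ^ θ * K ^ θ)) ^ k with hD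
    set c := couplingWeight C ρ (a, b) with hc
    have := hS.finite_Q (p + 1)
    have hm := hS.measurable_interp θ (p + 1) n
    have h1 : ∫⁻ z, couplingWeight C ρ z * ‖F.pairDiff φ (p + 1) n z‖ₑ
        ∂((F.Q (p + 1) a).prod (F.Q (p + 1) b)) ≤
        D * (((∫⁻ y, w y ∂(F.Q (p + 1) a)) ^ θ * F.mass p n a ^ (1 - θ)) *
          ((∫⁻ y, w y ∂(F.Q (p + 1) b)) ^ θ * F.mass p n b ^ (1 - θ))) := by
      calc _ ≤ ∫⁻ z, D * (F.interp w θ (p + 1) n z.1 * F.interp w θ (p + 1) n z.2)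
            ∂((F.Q (p + 1) a).prod (F.Q (p + 1) b)) := lintegral_mono fun z => ih z.1 z.2
        _ = D * ((∫⁻ y, F.interp w θ (p + 1) n y ∂(F.Q (p + 1) a)) *
              ∫⁻ y, F.interp w θ (p + 1) n y ∂(F.Q (p + 1) b)) := by
            rw [lintegral_const_mul D (f := fun z : X × X => F.interp w θ (p + 1) n z.1 *
                F.interp w θ (p + 1) n z.2) (by fun_prop),
              lintegral_prod_mul hm.aemeasurable hm.aemeasurable]
        _ ≤ _ := by
            gcongr
            · exact hS.lintegral_interp_le hθ0.le hθ1 hlt a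
            · exact hS.lintegral_interp_le hθ0.le hθ1 hlt b
    calc c * ‖F.pairDiff φ p n (a, b)‖ₑ
        ≤ c * (ρ * c * (D * (((∫⁻ y, w y ∂(F.Q (p + 1) a)) ^ θ * F.mass p n a ^ (1 - θ)) *
          ((∫⁻ y, w y ∂(F.Q (p + 1) b)) ^ θ * F.mass p n b ^ (1 - θ))))) := by
          gcongr
          refine (hS.enorm_pairDiff_le_lintegral hA hρ0 hρ1 hAρ hφ hB hlt a b).trans ?_
          exact mul_le_mul_right h1 _
      _ = ρ * D * (F.mass p n a ^ (1 - θ) * F.mass p n b ^ (1 - θ)) *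
            (c * c * ((∫⁻ y, w y ∂(F.Q (p + 1) a)) ^ θ * (∫⁻ y, w y ∂(F.Q (p + 1) b)) ^ θ)) := by
          ring
      _ ≤ ρ * D * (F.mass p n a ^ (1 - θ) * F.mass p n b ^ (1 - θ)) *
            (K ^ θ * K ^ θ * (w a ^ θ * w b ^ θ)) := by
          refine mul_le_mul_right ?_ _
          exact hS.couplingWeight_mul_le hρ0 hρ1 hθ0.le hκ p.succ_pos a b
      _ = _ := by
          rw [hD, interp, interp, pow_succ]; ring

lemma enorm_pairDiff_le (hS : F.StepBounds C w K κ A m) (hA : 1 ≤ A)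
    {ρ : ENNReal} (hρ0 : ρ ≠ 0) (hρ1 : ρ ≤ 1) (hAρ : 1 - (A * A)⁻¹ ≤ ρ) {θ : ℝ} (hθ0 : 0 < θ)
    (hθ1 : θ ≤ 1) (hκ : κ ^ θ ≤ ρ * ρ * K ^ θ) {φ : X → ℝ} (hφ : Measurable φ) {B : ℝ}
    (hB : ∀ x, |φ x| ≤ B) {p n : ℕ} (hpn : p ≤ n) (a b : X) :
    ‖F.pairDiff φ p n (a, b)‖ₑ ≤
      2 * ENNReal.ofReal B * ρ⁻¹ * (ρ * (K ^ θ * K ^ θ)) ^ (n - p) *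
        (F.interp w θ p n a * F.interp w θ p n b) := by
  obtain ⟨k, rfl⟩ := Nat.exists_eq_add_of_le hpn
  rw [Nat.add_sub_cancel_left]
  exact (le_mul_of_one_le_left' (one_le_couplingWeight C hρ1 _)).trans
    (hS.couplingWeight_mul_enorm_pairDiff_le hA hρ0 hρ1 hAρ hθ0 hθ1 hκ hφ hB k p a b)

end StepBounds

/-! ### From pairs to the centred normalized semigroup. -/

lemma integral_eta (F : FKModel X) (μ : Measure X) (n : ℕ) (f : X → ℝ) :
    ∫ x, f x ∂(F.eta μ n) = (F.gamma μ n Set.univ).toReal⁻¹ * ∫ x, f x ∂(F.gamma μ n) := by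
  rw [eta, integral_smul_measure, ENNReal.toReal_inv, smul_eq_mul]

section Normalized

variable {F : FKModel X} (hQ : ∀ n, IsFiniteKernel (F.Q n)) (μ : Measure X)
  [IsProbabilityMeasure μ] {φ : X → ℝ} (hφ : Measurable φ) {B : ℝ} (hB : ∀ x, |φ x| ≤ B)
include hQ hφ hB

lemma integrable_integral_gamma (p n : ℕ) :
    Integrable (fun x => ∫ y, φ y ∂(F.Qsemi p n x)) (F.gamma μ p) := by
  have := Qsemi_isFiniteKernel hQ p n
  have := gamma_isFiniteMeasure hQ μ p
  -- The measure `γ_p` is viewed as a constant kernel, so that the integral formulas for composed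
  -- kernels apply.
  exact (integrable_of_bounded hφ hB
    ((F.Qsemi p n ∘ₖ Kernel.const Unit (F.gamma μ p)) ())).integral_comp

lemma integral_gamma_eq {p n : ℕ} (hpn : p ≤ n) :
    ∫ y, φ y ∂(F.gamma μ n) = ∫ x, ∫ y, φ y ∂(F.Qsemi p n x) ∂(F.gamma μ p) := by
  have := Qsemi_isFiniteKernel hQ p n
  have := gamma_isFiniteMeasure hQ μ p
  have h := Kernel.integral_comp (integrable_of_bounded hφ hB
    ((F.Qsemi p n ∘ₖ Kernel.const Unit (F.gamma μ p)) ()))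
  rwa [Kernel.comp_apply, Kernel.const_apply, ← gamma_comp F μ hpn] at h

lemma integral_Qsemi_eta {p n : ℕ} (hpn : p ≤ n) :
    ∫ x, ∫ y, φ y ∂(F.Qsemi p n x) ∂(F.eta μ p) =
      (F.evid μ p n).toReal * ∫ y, φ y ∂(F.eta μ n) := by
  have := gamma_isFiniteMeasure hQ μ n
  have h0 : (F.gamma μ n Set.univ).toReal ≠ 0 :=
    ENNReal.toReal_ne_zero.2 ⟨F.gamma_univ_ne_zero μ n, measure_ne_top _ _⟩
  rw [integral_eta, integral_eta, evid_eq F μ hpn, ENNReal.toReal_mul, ENNReal.toReal_inv,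
    integral_gamma_eq hQ μ hφ hB hpn, mul_assoc, mul_inv_cancel_left₀ h0]

/-- Averaging `Q_{p,n}1` over `η_p` gives `evid μ p n`, and averaging `Q_{p,n}φ` gives the same
number times `η_n(φ)`; hence the two inverse factors. -/
lemma normalizedSemi_sub_eq {p n : ℕ} (hpn : p ≤ n) (x : X) :
    F.normalizedSemi μ φ p n x - F.h μ p n x * ∫ y, φ y ∂(F.eta μ n) =
      (∫ b, F.pairDiff φ p n (x, b) ∂(F.eta μ p)) *
        ((F.evid μ p n).toReal⁻¹ * (F.evid μ p n).toReal⁻¹) := by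
  have hZ : (F.evid μ p n).toReal ≠ 0 :=
    ENNReal.toReal_ne_zero.2 ⟨evid_ne_zero hQ μ hpn, evid_ne_top hQ μ hpn⟩
  have hg : (F.gamma μ p Set.univ)⁻¹ ≠ ⊤ := ENNReal.inv_ne_top.2 (F.gamma_univ_ne_zero μ p)
  have h1 : Integrable (fun b => (F.mass p n b).toReal) (F.eta μ p) := by
    simp only [mass_toReal]
    exact (integrable_integral_gamma (B := 1) hQ μ measurable_const (by simp) p n).smul_measure hg
  have h2 : Integrable (fun b => ∫ y, φ y ∂(F.Qsemi p n b)) (F.eta μ p) :=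
    (integrable_integral_gamma hQ μ hφ hB p n).smul_measure hg
  have h3 : ∫ b, (F.mass p n b).toReal ∂(F.eta μ p) = (F.evid μ p n).toReal :=
    integral_toReal (F.measurable_mass p n).aemeasurable
      (Filter.Eventually.of_forall fun b => (mass_ne_top hQ p n b).lt_top)
  simp only [pairDiff]
  rw [integral_sub (h1.const_mul _) (h2.const_mul _), integral_const_mul, integral_const_mul, h3,
    integral_Qsemi_eta hQ μ hφ hB hpn, h, normalizedSemi, normalizedSemi, prod_lam_eq hQ μ hpn,
    ← mass_toReal]
  field_simp

end Normalized

namespace StepBounds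

variable {F : FKModel X} {C : Set X} {w : X → ENNReal} {K κ A : ENNReal} {m : Measure X}

/-- Pointwise geometric bound on the centred normalized semigroup. -/
lemma enorm_normalizedSemi_sub_le (hS : F.StepBounds C w K κ A m) (hA : 1 ≤ A) (μ : Measure X)
    [IsProbabilityMeasure μ] {l H Y : ENNReal} (hl : ∀ p, l ≤ F.evid μ p (p + 1))
    (hH : ∀ p n, p ≤ n → ∀ x, F.mass p n x ≤ H * w x * F.evid μ p n)
    (hY : ∀ p, ∫⁻ x, w x ∂(F.eta μ p) ≤ Y)
    {ρ : ENNReal} (hρ0 : ρ ≠ 0) (hρ1 : ρ ≤ 1) (hAρ : 1 - (A * A)⁻¹ ≤ ρ) {θ : ℝ} (hθ0 : 0 < θ)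
    (hθ1 : θ ≤ 1) (hκ : κ ^ θ ≤ ρ * ρ * K ^ θ) {φ : X → ℝ} (hφ : Measurable φ) {B : ℝ}
    (hB : ∀ x, |φ x| ≤ B) {p n : ℕ} (hpn : p ≤ n) (x : X) :
    ‖F.normalizedSemi μ φ p n x - F.h μ p n x * ∫ y, φ y ∂(F.eta μ n)‖ₑ ≤
      2 * ρ⁻¹ * H ^ (1 - θ) * Y ^ θ * ENNReal.ofReal B *
        (ρ * ((K * l⁻¹) ^ θ * (K * l⁻¹) ^ θ)) ^ (n - p) * w x := by
  have hQ := hS.finite_Q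
  set Z := F.evid μ p n with hZ
  have hZ0 : Z ≠ 0 := evid_ne_zero hQ μ hpn
  have hZt : Z ≠ ⊤ := evid_ne_top hQ μ hpn
  have hθ' : 0 ≤ 1 - θ := by linarith
  rw [normalizedSemi_sub_eq hQ μ hφ hB hpn, enorm_mul]
  have hinv : ‖Z.toReal⁻¹ * Z.toReal⁻¹‖ₑ = Z⁻¹ * Z⁻¹ := by
    have h1 : ‖Z.toReal⁻¹‖ₑ = Z⁻¹ := by
      rw [← ENNReal.toReal_inv, Real.enorm_of_nonneg ENNReal.toReal_nonneg,
        ENNReal.ofReal_toReal (ENNReal.inv_ne_top.2 hZ0)]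
    rw [enorm_mul, h1]
  rw [hinv]
  have hint : ∫⁻ b, F.interp w θ p n b ∂(F.eta μ p) ≤ Y ^ θ * Z ^ (1 - θ) := by
    refine (ENNReal.lintegral_mul_norm_pow_le hS.measurable_w.aemeasurable
      (F.measurable_mass p n).aemeasurable hθ0.le hθ' (by ring)).trans ?_
    exact mul_le_mul' (ENNReal.rpow_le_rpow (hY p) hθ0.le) le_rfl
  -- At `x` the mass is replaced by its bound `H * w x * Z`, so the powers of `w x` add up to one.
  have hm : F.interp w θ p n x ≤ H ^ (1 - θ) * w x * Z ^ (1 - θ) := by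
    calc F.interp w θ p n x ≤ w x ^ θ * (H * w x * Z) ^ (1 - θ) :=
          mul_le_mul_right (ENNReal.rpow_le_rpow (hH p n hpn x) hθ') _
      _ = H ^ (1 - θ) * (w x ^ θ * w x ^ (1 - θ)) * Z ^ (1 - θ) := by
          rw [ENNReal.mul_rpow_of_nonneg _ _ hθ', ENNReal.mul_rpow_of_nonneg _ _ hθ']; ring
      _ = _ := by
          rw [← ENNReal.rpow_add_of_nonneg _ _ hθ0.le hθ', add_sub_cancel, ENNReal.rpow_one]
  -- Each of the two copies leaves `Z ^ (-θ)`, and `Z` is at least `l ^ (n - p)`.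
  have hZpow : Z ^ (1 - θ) * Z⁻¹ ≤ ((l⁻¹) ^ θ) ^ (n - p) := by
    have h1 : Z ^ (1 - θ) * Z⁻¹ = (Z⁻¹) ^ θ := by
      rw [← ENNReal.rpow_neg_one Z, ← ENNReal.rpow_add _ _ hZ0 hZt, ← ENNReal.rpow_mul]
      congr 1; ring
    rw [h1, ← ENNReal.rpow_natCast, ← ENNReal.rpow_mul, mul_comm θ, ENNReal.rpow_mul,
      ENNReal.rpow_natCast]
    refine ENNReal.rpow_le_rpow ?_ hθ0.le
    rw [← ENNReal.inv_pow]
    exact ENNReal.inv_le_inv.2 (pow_le_evid hQ μ hl hpn)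
  set D := 2 * ENNReal.ofReal B * ρ⁻¹ * (ρ * (K ^ θ * K ^ θ)) ^ (n - p) with hD
  have hpair : ‖∫ b, F.pairDiff φ p n (x, b) ∂(F.eta μ p)‖ₑ ≤
      D * ((H ^ (1 - θ) * w x * Z ^ (1 - θ)) * (Y ^ θ * Z ^ (1 - θ))) := by
    calc _ ≤ ∫⁻ b, ‖F.pairDiff φ p n (x, b)‖ₑ ∂(F.eta μ p) := enorm_integral_le_lintegral_enorm _
      _ ≤ ∫⁻ b, D * F.interp w θ p n x * F.interp w θ p n b ∂(F.eta μ p) :=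
          lintegral_mono fun b => by
            rw [mul_assoc]
            exact hS.enorm_pairDiff_le hA hρ0 hρ1 hAρ hθ0 hθ1 hκ hφ hB hpn x b
      _ = D * (F.interp w θ p n x * ∫⁻ b, F.interp w θ p n b ∂(F.eta μ p)) := by
          rw [lintegral_const_mul _ (hS.measurable_interp θ p n), mul_assoc]
      _ ≤ _ := mul_le_mul_right (mul_le_mul' hm hint) _
  calc _ ≤ D * ((H ^ (1 - θ) * w x * Z ^ (1 - θ)) * (Y ^ θ * Z ^ (1 - θ))) * (Z⁻¹ * Z⁻¹) :=
        mul_le_mul_left hpair _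
    _ = D * H ^ (1 - θ) * Y ^ θ * w x * ((Z ^ (1 - θ) * Z⁻¹) * (Z ^ (1 - θ) * Z⁻¹)) := by ring
    _ ≤ D * H ^ (1 - θ) * Y ^ θ * w x * (((l⁻¹) ^ θ) ^ (n - p) * ((l⁻¹) ^ θ) ^ (n - p)) :=
        mul_le_mul_right (mul_le_mul' hZpow hZpow) _
    _ = _ := by
        rw [hD, ENNReal.mul_rpow_of_nonneg _ _ hθ0.le]
        simp only [mul_pow]
        ring

end StepBounds

/-! ### Choice of the weight and of the constants. -/

/-- The square root of the drift function. -/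
noncomputable def sqrtExpV {X : Type*} (V : X → ℝ) (x : X) : ENNReal := expV V x ^ (2⁻¹ : ℝ)

lemma one_le_expV {X : Type*} {V : X → ℝ} (hV : ∀ x, 1 ≤ V x) (x : X) : 1 ≤ expV V x := by
  rw [expV, ENNReal.one_le_ofReal]
  exact Real.one_le_exp (zero_le_one.trans (hV x))

lemma sqrtExpV_sq {X : Type*} (V : X → ℝ) (x : X) : sqrtExpV V x ^ 2 = expV V x := by
  rw [sqrtExpV, ← ENNReal.rpow_natCast, ← ENNReal.rpow_mul]
  norm_num

lemma one_le_sqrtExpV {X : Type*} {V : X → ℝ} (hV : ∀ x, 1 ≤ V x) (x : X) : 1 ≤ sqrtExpV V x :=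
  ENNReal.one_le_rpow (one_le_expV hV x) (by norm_num)

lemma sqrtExpV_le {X : Type*} {V : X → ℝ} (hV : ∀ x, 1 ≤ V x) (x : X) : sqrtExpV V x ≤ expV V x := by
  rw [← sqrtExpV_sq, sq]
  exact le_mul_of_one_le_left' (one_le_sqrtExpV hV x)

/-- Cauchy-Schwarz against the constant `1`, whose integral under `Q n x` is a potential, hence at
most `Gbar`. -/
lemma lintegral_sqrtExpV_le {F : FKModel X} {V : X → ℝ} (hV : Measurable V) {Gbar : ℝ}
    (hG : F.BoundedPotentials Gbar) (n : ℕ) (x : X) {k : ENNReal}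
    (hk : ∫⁻ y, expV V y ∂(F.Q n x) ≤ k * expV V x) :
    ∫⁻ y, sqrtExpV V y ∂(F.Q n x) ≤
      (ENNReal.ofReal Gbar * k) ^ (2⁻¹ : ℝ) * sqrtExpV V x := by
  have h2 : (0 : ℝ) ≤ 2⁻¹ := by norm_num
  have h := ENNReal.lintegral_mul_norm_pow_le (μ := F.Q n x) (f := expV V) (g := fun _ => 1)
    (p := 2⁻¹) (q := 2⁻¹) (measurable_expV hV).aemeasurable aemeasurable_const h2 h2 (by norm_num)
  simp only [ENNReal.one_rpow, mul_one, lintegral_one, Q_univ] at h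
  calc _ ≤ (∫⁻ y, expV V y ∂(F.Q n x)) ^ (2⁻¹ : ℝ) *
        ENNReal.ofReal (F.G (n - 1) x) ^ (2⁻¹ : ℝ) := h
    _ ≤ (k * expV V x) ^ (2⁻¹ : ℝ) * ENNReal.ofReal Gbar ^ (2⁻¹ : ℝ) :=
        mul_le_mul' (ENNReal.rpow_le_rpow hk h2)
          (ENNReal.rpow_le_rpow (ENNReal.ofReal_le_ofReal (hG _ x)) h2)
    _ = _ := by
        rw [sqrtExpV, ENNReal.mul_rpow_of_nonneg _ _ h2, ENNReal.mul_rpow_of_nonneg _ _ h2]; ring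

lemma stepBounds_sqrtExpV {F : FKModel X} {V : X → ℝ} {δ dlow Gbar : ℝ} {b εm εp : ℝ → ℝ}
    {ν : ℝ → Measure X} (hD : F.Drift V δ dlow b) (hM : F.Minorization V dlow εm ν)
    (hJ : F.Majorization V dlow εm εp ν) (hG : F.BoundedPotentials Gbar) {d : ℝ} (hd : dlow ≤ d) :
    F.StepBounds (levelSet V d) (sqrtExpV V)
      ((ENNReal.ofReal Gbar * ENNReal.ofReal (Real.exp |b dlow|)) ^ (2⁻¹ : ℝ))
      ((ENNReal.ofReal Gbar * ENNReal.ofReal (Real.exp (|b dlow| - δ * d))) ^ (2⁻¹ : ℝ))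
      (ENNReal.ofReal (εp d) / ENNReal.ofReal (εm d))
      (ENNReal.ofReal (εm d) • (ν d).restrict (levelSet V d)) where
  finite_Q := hG.isFiniteKernel_Q
  measurableSet_C := measurableSet_levelSet hD.measurable_V d
  measurable_w := (measurable_expV hD.measurable_V).pow_const _
  one_le_w := one_le_sqrtExpV hD.one_le_V
  growth n hn x := lintegral_sqrtExpV_le hD.measurable_V hG n x (hD.lintegral_expV_le hn x)
  growth_off n hn x hx :=
    lintegral_sqrtExpV_le hD.measurable_V hG n x (hD.lintegral_expV_le_of_notMem hn hx)
  finite_m := by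
    have := (hM.nu_mem d hd).1
    refine ⟨?_⟩
    rw [Measure.smul_apply, smul_eq_mul]
    exact ENNReal.mul_lt_top ENNReal.ofReal_lt_top (measure_lt_top _ _)
  A_ne_top := ENNReal.div_ne_top ENNReal.ofReal_ne_top
    (ENNReal.ofReal_pos.2 (hM.eps_pos d hd)).ne'
  lower n hn x hx := by
    refine Measure.le_iff.2 fun s hs => ?_
    rw [Measure.smul_apply, smul_eq_mul, Measure.restrict_apply hs, Measure.restrict_apply hs,
      Set.inter_comm]
    exact hM.minor d hd n hn x hx s hs
  upper n hn x hx := by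
    refine Measure.le_iff.2 fun s hs => ?_
    rw [smul_smul, ENNReal.div_mul_cancel (ENNReal.ofReal_pos.2 (hM.eps_pos d hd)).ne'
      ENNReal.ofReal_ne_top, Measure.smul_apply, smul_eq_mul, Measure.restrict_apply hs,
      Measure.restrict_apply hs, Set.inter_comm]
    exact hJ.major d hd n hn x hx s hs

/-- Take `θ = 1 / n` with `t ^ n ≤ s`. -/
lemma exists_rpow_ge {t s : ENNReal} (ht : t < 1) (hs : s ≠ 0) :
    ∃ θ : ℝ, 0 < θ ∧ θ ≤ 1 ∧ t ≤ s ^ θ := by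
  obtain ⟨n, hn, hn1⟩ := (((ENNReal.tendsto_pow_atTop_nhds_zero_of_lt_one ht).eventually_le_const
    (pos_iff_ne_zero.2 hs)).and (Filter.eventually_ge_atTop 1)).exists
  have hn0 : (0 : ℝ) < n := by exact_mod_cast hn1
  refine ⟨(n : ℝ)⁻¹, inv_pos.2 hn0, inv_le_one_of_one_le₀ (by exact_mod_cast hn1), ?_⟩
  calc t = (t ^ n) ^ (n : ℝ)⁻¹ := (ENNReal.pow_rpow_inv_natCast (by omega) t).symm
    _ ≤ _ := ENNReal.rpow_le_rpow hn (inv_pos.2 hn0).le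

/-- Uniform geometric bound on the centred normalized semigroup, with constants that depend on the
model only through the parameters of the assumptions. -/
lemma exists_enorm_normalizedSemi_sub_le {μ : Measure X} {V : X → ℝ} {δ dlow Gbar : ℝ}
    {b εm εp : ℝ → ℝ} {ν : ℝ → Measure X} {F₀ : FKModel X} (hμ : MemPv V μ)
    (hD₀ : F₀.Drift V δ dlow b) (hM₀ : F₀.Minorization V dlow εm ν)
    (hJ₀ : F₀.Majorization V dlow εm εp ν) (hG₀ : F₀.BoundedPotentials Gbar) :
    ∃ S r Y : ENNReal, S ≠ ⊤ ∧ r < 1 ∧ Y ≠ ⊤ ∧ ∀ F : FKModel X, F.Drift V δ dlow b →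
      F.Minorization V dlow εm ν → F.Majorization V dlow εm εp ν → F.BoundedPotentials Gbar →
      (∀ n, ∫⁻ x, expV V x ∂(F.eta μ n) ≤ Y) ∧
      ∀ φ : X → ℝ, Measurable φ → ∀ B : ℝ, (∀ x, |φ x| ≤ B) → ∀ p n, p ≤ n → ∀ x,
        ‖F.normalizedSemi μ φ p n x - F.h μ p n x * ∫ y, φ y ∂(F.eta μ n)‖ₑ ≤
          S * ENNReal.ofReal B * r ^ (n - p) * sqrtExpV V x := by
  have hμ1 := hμ.1
  have hV := hD₀.measurable_V
  obtain ⟨Y, hYt, hY⟩ := exists_lintegral_expV_eta_le hμ hD₀ hM₀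
  have hGpos : 0 < Gbar := by
    obtain ⟨x⟩ := μ.nonempty_of_neZero
    exact (F₀.G_pos 0 x).trans_le (hG₀ 0 x)
  -- The bound `l` is fixed by an auxiliary level `d₁`, before the level `d` of the contraction is
  -- chosen: `d` must be large in terms of `l`, while `εm d` may decay in `d`.
  obtain ⟨d₁, hd₁, hhalf₁⟩ := ((Filter.eventually_ge_atTop dlow).and
    (eventually_half_le_levelSet hV hYt)).exists
  set l : ENNReal := ENNReal.ofReal (εm d₁) * ν d₁ (levelSet V d₁) * (1 / 2) with hl
  have hl0 : l ≠ 0 := mul_ne_zero (hM₀.const_ne_zero ⟨hd₁, le_rfl⟩) (by simp)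
  have hlt : l ≠ ⊤ := by
    have := (hM₀.nu_mem d₁ hd₁).1
    exact ENNReal.mul_ne_top (ENNReal.mul_ne_top ENNReal.ofReal_ne_top (measure_ne_top _ _))
      (by simp)
  have h2 : (0 : ℝ) ≤ 2⁻¹ := by norm_num
  have hgb0 : ENNReal.ofReal Gbar ≠ 0 := (ENNReal.ofReal_pos.2 hGpos).ne'
  set K : ENNReal := (ENNReal.ofReal Gbar * ENNReal.ofReal (Real.exp |b dlow|)) ^ (2⁻¹ : ℝ) with hK
  have hKt : K ≠ ⊤ := ENNReal.rpow_ne_top_of_nonneg h2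
    (ENNReal.mul_ne_top ENNReal.ofReal_ne_top ENNReal.ofReal_ne_top)
  have hK0 : K ≠ 0 := by
    have h1 : ENNReal.ofReal Gbar * ENNReal.ofReal (Real.exp |b dlow|) ≠ 0 :=
      mul_ne_zero hgb0 (ENNReal.ofReal_pos.2 (Real.exp_pos _)).ne'
    exact fun h => h1 ((ENNReal.rpow_eq_zero_iff_of_pos (by norm_num)).1 h)
  set σ : ENNReal := 2 * K * l⁻¹ + 1 with hσ
  have hσt : σ ≠ ⊤ := ENNReal.add_ne_top.2 ⟨ENNReal.mul_ne_top (ENNReal.mul_ne_top (by simp) hKt)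
    (ENNReal.inv_ne_top.2 hl0), by simp⟩
  have hσ1 : 1 ≤ σ := le_add_self
  have hσl : 2 * K ≤ σ * l := by
    rw [hσ, add_mul, mul_assoc, ENNReal.inv_mul_cancel hl0 hlt, mul_one]
    exact le_self_add
  set a : ENNReal := (K * l⁻¹) * (K * l⁻¹) with ha
  have hKlt : K * l⁻¹ ≠ ⊤ := ENNReal.mul_ne_top hKt (ENNReal.inv_ne_top.2 hl0)
  have hat : a ≠ ⊤ := ENNReal.mul_ne_top hKlt hKlt
  -- With `ρ = L⁻¹ ^ θ` the final rate is `(L⁻¹ * a) ^ θ`, which is less than one for every positive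
  -- `θ`.
  set L : ENNReal := a + 1 with hL
  have hLt : L ≠ ⊤ := ENNReal.add_ne_top.2 ⟨hat, by simp⟩
  have hL0 : L ≠ 0 := by simp [hL]
  have hLi0 : L⁻¹ ≠ 0 := ENNReal.inv_ne_zero.2 hLt
  have hLi1 : L⁻¹ ≤ 1 := ENNReal.inv_le_one.2 le_add_self
  have hLa : L⁻¹ * a < 1 := by
    rw [mul_comm, ← div_eq_mul_inv, ENNReal.div_lt_iff (Or.inl hL0) (Or.inl hLt), one_mul]
    exact ENNReal.lt_add_right hat one_ne_zero
  -- The two entries are the requirements `σ * κ ≤ l` and `κ ≤ L⁻¹ * L⁻¹ * K`. The second, raised to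
  -- the power `θ`, is the condition on `κ` and `ρ` whatever `θ` is, so `d` can be fixed before `θ`.
  set c : ENNReal := min (σ⁻¹ * l) (L⁻¹ * L⁻¹ * K) with hc
  have hc0 : c ≠ 0 := by
    have h1 : 0 < σ⁻¹ * l := pos_iff_ne_zero.2 (mul_ne_zero (ENNReal.inv_ne_zero.2 hσt) hl0)
    have h3 : 0 < L⁻¹ * L⁻¹ * K := pos_iff_ne_zero.2 (mul_ne_zero (mul_ne_zero hLi0 hLi0) hK0)
    exact (lt_min h1 h3).ne'
  have hc2 : (ENNReal.ofReal Gbar)⁻¹ * c ^ 2 ≠ 0 :=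
    mul_ne_zero (ENNReal.inv_ne_zero.2 ENNReal.ofReal_ne_top) (pow_ne_zero _ hc0)
  obtain ⟨d, hd, hhalf, hexp⟩ := ((Filter.eventually_ge_atTop dlow).and
    ((eventually_half_le_levelSet hV hYt).and
      (eventually_ofReal_exp_le hD₀.delta_pos |b dlow| hc2))).exists
  set κ : ENNReal :=
    (ENNReal.ofReal Gbar * ENNReal.ofReal (Real.exp (|b dlow| - δ * d))) ^ (2⁻¹ : ℝ) with hκ
  have hκc : κ ≤ c := by
    calc κ ≤ (ENNReal.ofReal Gbar * ((ENNReal.ofReal Gbar)⁻¹ * c ^ 2)) ^ (2⁻¹ : ℝ) :=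
          ENNReal.rpow_le_rpow (mul_le_mul_right hexp _) h2
      _ = c := by
          rw [ENNReal.mul_inv_cancel_left hgb0 ENNReal.ofReal_ne_top, ← ENNReal.rpow_natCast,
            ← ENNReal.rpow_mul]
          norm_num
  have hσκ : σ * κ ≤ l := by
    have hσ0 : σ ≠ 0 := (zero_lt_one.trans_le hσ1).ne'
    calc σ * κ ≤ σ * (σ⁻¹ * l) := mul_le_mul_right (hκc.trans (min_le_left _ _)) _
      _ = l := ENNReal.mul_inv_cancel_left hσ0 hσt
  set A : ENNReal := ENNReal.ofReal (εp d) / ENNReal.ofReal (εm d) with hA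
  have hεm0 : ENNReal.ofReal (εm d) ≠ 0 := (ENNReal.ofReal_pos.2 (hM₀.eps_pos d hd)).ne'
  have hA1 : 1 ≤ A := by
    rw [hA, ENNReal.le_div_iff_mul_le (Or.inl hεm0) (Or.inl ENNReal.ofReal_ne_top), one_mul]
    exact ENNReal.ofReal_le_ofReal (hJ₀.eps_le d hd)
  have hAt : A ≠ ⊤ := ENNReal.div_ne_top ENNReal.ofReal_ne_top hεm0
  have hAA : 1 - (A * A)⁻¹ < 1 :=
    ENNReal.sub_lt_self ENNReal.one_ne_top one_ne_zero
      (ENNReal.inv_ne_zero.2 (ENNReal.mul_ne_top hAt hAt))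
  -- The comparison constant `A` depends on `d`, so `θ` comes last: it is small enough for `L⁻¹ ^ θ`
  -- to dominate the local contraction factor `1 - (A * A)⁻¹`.
  obtain ⟨θ, hθ0, hθ1, hθ⟩ := exists_rpow_ge hAA hLi0
  set ρ : ENNReal := L⁻¹ ^ θ with hρ
  have hρ0 : ρ ≠ 0 := fun h => hLi0 ((ENNReal.rpow_eq_zero_iff_of_pos hθ0).1 h)
  have hρ1 : ρ ≤ 1 := ENNReal.rpow_le_one hLi1 hθ0.le
  have hκθ : κ ^ θ ≤ ρ * ρ * K ^ θ := by
    rw [hρ, ← ENNReal.mul_rpow_of_nonneg _ _ hθ0.le, ← ENNReal.mul_rpow_of_nonneg _ _ hθ0.le]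
    exact ENNReal.rpow_le_rpow (hκc.trans (min_le_right _ _)) hθ0.le
  set r : ENNReal := ρ * ((K * l⁻¹) ^ θ * (K * l⁻¹) ^ θ) with hr
  have hr1 : r < 1 := by
    rw [hr, hρ, ← ENNReal.mul_rpow_of_nonneg _ _ hθ0.le, ← ENNReal.mul_rpow_of_nonneg _ _ hθ0.le]
    exact ENNReal.rpow_lt_one hLa hθ0
  have hHt : 4 * A * σ ≠ ⊤ := ENNReal.mul_ne_top (ENNReal.mul_ne_top (by simp) hAt) hσt
  refine ⟨2 * ρ⁻¹ * (4 * A * σ) ^ (1 - θ) * Y ^ θ, r, Y, ?_, hr1, hYt, fun F hD hM hJ hG => ?_⟩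
  · exact ENNReal.mul_ne_top (ENNReal.mul_ne_top
      (ENNReal.mul_ne_top (by simp) (ENNReal.inv_ne_top.2 hρ0))
      (ENNReal.rpow_ne_top_of_nonneg (by linarith) hHt))
      (ENNReal.rpow_ne_top_of_nonneg hθ0.le hYt)
  have hS := stepBounds_sqrtExpV hD hM hJ hG hd
  have hQ := hS.finite_Q
  have hYF := hY F hD hM hQ
  have hηp := eta_isProbabilityMeasure hQ μ
  have hle : ∀ p, l ≤ F.evid μ p (p + 1) := fun p =>
    hM.le_evid_succ hV μ hd₁ p (hhalf₁ _ (hηp p) (hYF p))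
  refine ⟨hYF, fun φ hφ B hB p n hpn x => ?_⟩
  refine hS.enorm_normalizedSemi_sub_le hA1 μ hle (fun p n hpn x => ?_) (fun p => ?_) hρ0 hρ1
    hθ hθ0 hθ1 hκθ hφ hB hpn x
  · exact hS.mass_le hA1 μ hle hσ1 hσl hσκ (fun p => hhalf _ (hηp p) (hYF p)) hpn x
  · exact (lintegral_mono (sqrtExpV_le hD.one_le_V)).trans (hYF p)

/-! ### Summation over time. -/

lemma sum_range_pow_sub_le {s : ℝ} (hs0 : 0 ≤ s) (hs1 : s < 1) (n : ℕ) :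
    ∑ p ∈ Finset.range n, s ^ (n - p) ≤ (1 - s)⁻¹ := by
  have h1 : ∑ p ∈ Finset.range n, s ^ (n - p) = ∑ p ∈ Finset.range n, s ^ (p + 1) := by
    rw [← Finset.sum_range_reflect]
    refine Finset.sum_congr rfl fun p hp => ?_
    have := Finset.mem_range.1 hp
    congr 1; omega
  rw [h1, ← tsum_geometric_of_lt_one hs0 hs1]
  calc _ ≤ ∑ p ∈ Finset.range n, s ^ p := Finset.sum_le_sum fun p _ =>
        pow_le_pow_of_le_one hs0 hs1.le p.le_succ
    _ ≤ _ := (summable_geometric_of_lt_one hs0 hs1).sum_le_tsum _ fun p _ => pow_nonneg hs0 p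

/-- Passing through the lower integral avoids any measurability or integrability condition on `f`.
-/
lemma integral_sq_le_of_enorm_le {η : Measure X} {f : X → ℝ} {w : X → ENNReal} {a Y : ENNReal}
    (hf : ∀ x, ‖f x‖ₑ ≤ a * w x) (hw : Measurable w) (hY : ∫⁻ x, w x ^ 2 ∂η ≤ Y) (ha : a ≠ ⊤)
    (hYt : Y ≠ ⊤) : ∫ x, f x ^ 2 ∂η ≤ a.toReal ^ 2 * Y.toReal := by
  have h1 : ‖∫ x, f x ^ 2 ∂η‖ₑ ≤ a ^ 2 * Y :=
    calc _ ≤ ∫⁻ x, ‖f x ^ 2‖ₑ ∂η := enorm_integral_le_lintegral_enorm _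
      _ ≤ ∫⁻ x, a ^ 2 * w x ^ 2 ∂η := lintegral_mono fun x => by
          rw [enorm_pow, ← mul_pow]
          exact pow_le_pow_left' (hf x) 2
      _ = a ^ 2 * ∫⁻ x, w x ^ 2 ∂η := lintegral_const_mul _ (hw.pow_const 2)
      _ ≤ _ := mul_le_mul_right hY _
  rw [Real.enorm_of_nonneg (integral_nonneg fun x => sq_nonneg _)] at h1
  have h2 := (ENNReal.ofReal_le_iff_le_toReal
    (ENNReal.mul_ne_top (ENNReal.pow_ne_top ha) hYt)).1 h1
  rwa [ENNReal.toReal_mul, ENNReal.toReal_pow] at h2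

lemma MemPv.one_le_integral {μ : Measure X} {V : X → ℝ} (hμ : MemPv V μ) (hV : Measurable V)
    (hV1 : ∀ x, 1 ≤ V x) : 1 ≤ ∫ x, Real.exp (V x) ∂μ := by
  have := hμ.1
  have h1 : Integrable (fun x => Real.exp (V x)) μ := by
    refine ⟨(Real.measurable_exp.comp hV).aestronglyMeasurable, ?_⟩
    rw [hasFiniteIntegral_iff_ofReal (Filter.Eventually.of_forall fun x => (Real.exp_pos _).le)]
    exact hμ.2
  calc (1 : ℝ) = ∫ _, (1 : ℝ) ∂μ := by simp
    _ ≤ _ := integral_mono (integrable_const _) h1 fun x =>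
        Real.one_le_exp (zero_le_one.trans (hV1 x))

lemma abs_le_weightedNorm_one {X : Type*} {φ : X → ℝ} (hφ : ∃ B : ℝ, ∀ x, |φ x| ≤ B) (x : X) :
    |φ x| ≤ weightedNorm (fun _ => 1) φ := by
  obtain ⟨B, hB⟩ := hφ
  have h := le_ciSup (f := fun x => |φ x| / 1)
    ⟨B, by rintro _ ⟨y, rfl⟩; simpa using hB y⟩ x
  simpa [weightedNorm] using h

end FKModel

theorem proposition6 {X : Type*} [TopologicalSpace X] [PolishSpace X] [MeasurableSpace X]
    [BorelSpace X] (μ : Measure X) (V : X → ℝ) (δ dlow : ℝ) (b εm εp : ℝ → ℝ)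
    (ν : ℝ → Measure X) (Gbar : ℝ) (hμ : FKModel.MemPv V μ) :
    ∃ c : ℝ, ∀ F : FKModel X,
      F.Drift V δ dlow b →
      F.Minorization V dlow εm ν →
      F.Majorization V dlow εm εp ν →
      F.BoundedPotentials Gbar →
      ∀ φ : X → ℝ, Measurable φ → (∃ B : ℝ, ∀ x, |φ x| ≤ B) →
      ∀ n : ℕ, 1 ≤ n →
        F.sigmaSq μ φ n ≤ F.varEta μ φ n +
          c * FKModel.weightedNorm (fun _ => 1) φ ^ 2 * (∫ x, Real.exp (V x) ∂μ) ^ 2 := by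
  -- The constants are built from facts about the parameters (signs, finiteness, measurability) that
  -- hold only if some model satisfies the assumptions; otherwise the claim is vacuous.
  by_cases hex : ∃ F₀ : FKModel X, F₀.Drift V δ dlow b ∧ F₀.Minorization V dlow εm ν ∧
      F₀.Majorization V dlow εm εp ν ∧ F₀.BoundedPotentials Gbar
  swap
  · exact ⟨0, fun F h1 h2 h3 h4 => absurd ⟨F, h1, h2, h3, h4⟩ hex⟩
  obtain ⟨F₀, hD₀, hM₀, hJ₀, hG₀⟩ := hex
  obtain ⟨S, r, Y, hS, hr, hY, H⟩ :=
    FKModel.exists_enorm_normalizedSemi_sub_le hμ hD₀ hM₀ hJ₀ hG₀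
  have hr0 : 0 ≤ r.toReal ^ 2 := sq_nonneg _
  have hrt : r ≠ ⊤ := hr.ne_top
  have hr1 : r.toReal ^ 2 < 1 := by
    have : r.toReal < 1 := by
      rw [← ENNReal.toReal_one]
      exact (ENNReal.toReal_lt_toReal hrt ENNReal.one_ne_top).2 hr
    exact pow_lt_one₀ ENNReal.toReal_nonneg this two_ne_zero
  refine ⟨S.toReal ^ 2 * Y.toReal * (1 - r.toReal ^ 2)⁻¹, fun F hD hM hJ hG φ hφ hφB n _ => ?_⟩
  obtain ⟨hYF, hF⟩ := H F hD hM hJ hG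
  set N := FKModel.weightedNorm (fun _ => 1) φ with hN
  have hNφ : ∀ x, |φ x| ≤ N := FKModel.abs_le_weightedNorm_one hφB
  have hN0 : 0 ≤ N := Real.iSup_nonneg fun x => by positivity
  have hterm : ∀ p ∈ Finset.range n,
      ∫ x, (F.normalizedSemi μ φ p n x - F.h μ p n x * ∫ y, φ y ∂(F.eta μ n)) ^ 2 ∂(F.eta μ p) ≤
        S.toReal ^ 2 * Y.toReal * N ^ 2 * (r.toReal ^ 2) ^ (n - p) := by
    intro p hp
    refine (FKModel.integral_sq_le_of_enorm_le (hF φ hφ N hNφ p n (Finset.mem_range.1 hp).le)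
      ((FKModel.measurable_expV hD.measurable_V).pow_const _) ?_
      (ENNReal.mul_ne_top (ENNReal.mul_ne_top hS ENNReal.ofReal_ne_top) (ENNReal.pow_ne_top hrt))
      hY).trans_eq ?_
    · exact (lintegral_congr fun x => FKModel.sqrtExpV_sq V x).trans_le (hYF p)
    · rw [ENNReal.toReal_mul, ENNReal.toReal_mul, ENNReal.toReal_pow, ENNReal.toReal_ofReal hN0]
      ring
  have hμ1 := hμ.one_le_integral hD.measurable_V hD.one_le_V
  rw [FKModel.sigmaSq]
  gcongr
  have hinv : 0 ≤ (1 - r.toReal ^ 2)⁻¹ := inv_nonneg.2 (by linarith)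
  calc _ ≤ ∑ p ∈ Finset.range n, S.toReal ^ 2 * Y.toReal * N ^ 2 * (r.toReal ^ 2) ^ (n - p) :=
        Finset.sum_le_sum hterm
    _ ≤ S.toReal ^ 2 * Y.toReal * N ^ 2 * (1 - r.toReal ^ 2)⁻¹ := by
        rw [← Finset.mul_sum]
        gcongr
        exact FKModel.sum_range_pow_sub_le hr0 hr1 n
    _ = S.toReal ^ 2 * Y.toReal * (1 - r.toReal ^ 2)⁻¹ * N ^ 2 * 1 := by ring
    -- The factor `μ(v) ^ 2` is at least one, so it can be inserted freely; the dependence on `μ`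
    -- already sits in the constant.
    _ ≤ _ := by
        gcongr
        exact one_le_pow₀ hμ1
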